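/- **Setting.** Let $\mathbb U\subset\mathfrak{gl}(N,\mathbb R)$ be a semisimple Lie algebra of real matrices stable under transposition, $\mathrm U\subset GL(N,\mathbb R)$ the group generated by $\exp\mathbb U$, and $\mathrm H=\mathrm U\cap \mathrm O(N)$. Put $\mathbb H=\{X\in\mathbb U: X^T=-X\}$ and $\mathbb K=\{X\in\mathbb U: X^T=X\}$, so that $\mathbb U=\mathbb H\oplus\mathbb K$. Assume that $\mathrm U/\mathrm H$ is Kähler: there is $X_c\in\mathbb H$ (the generator of the central $\mathfrak{so}(2)$) with $[X_c,\mathbb H]=0$ and $[X_c,[X_c,Y]]=-c^2\,Y$ for all $Y\in\mathbb K$, for some real $c\neq0$. *Solvable coordinates.* Let $T_1,\dots,T_d$ be a basis of a Lie subalgebra $Solv\subset\mathbb U$ with $\mathbb U=\mathbb H\oplus Solv$ (as vector spaces), such that $T_1,\dots,T_r$ are diagonal (Cartan generators), and $T_{r+1},\dots,T_d$ are strictly upper triangular and are common eigenvectors of $\mathrm{ad}\,T_1,\dots,\mathrm{ad}\,T_r$, with positive eigenvalues for $\mathrm{ad}\,h$ for some fixed $h\in\mathrm{span}(T_1,\dots,T_r)$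 (positive restricted roots). For $\Upsilon\in\mathbb R^d$ let $$\mathbb L(\Upsilon)=\exp(\Upsilon^1T_1)\exp(\Upsilon^2T_2)\cdots\exp(\Upsilon^dT_d),$$ and let $\Upsilon$ be the coordinates of the point $\mathbb L(\Upsilon)\mathrm H\in\mathrm U/\mathrm H$. For $g\in\mathrm U$ the transformed coordinates $g(\Upsilon)$ are defined by $g\,\mathbb L(\Upsilon)\in\mathbb L(g(\Upsilon))\,\mathrm H$. For $J\in\mathbb U$ the Killing vector field $\mathfrak k_J=\mathfrak f_J^\alpha(\Upsilon)\,\partial/\partial\Upsilon^\alpha$ is given by $\mathfrak f_J(\Upsilon)=\frac{d}{d\theta}\big|_{\theta=0}\exp(\theta J)(\Upsilon)$. *Kähler 2-form.* Let $\Theta=\mathbb L^{-1}d\mathbb L$, let $K^1,\dots,K^d$ be a basis of $\mathbb K$ with $\mathrm{Tr}(K^AK^B)=\delta^{AB}$, let $V^A=\mathrm{Tr}(\Theta K^A)$ and $$\mathbf K^c_{AB}=\tfrac12\mathrm{Tr}\big([X_c,K^A]K^B\big),\qquad \mathcal K=\sum_{A,B}\mathbf K^c_{AB}\,V^A\wedge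 V^B ,$$ where $\alpha\wedge\beta=\tfrac12(\alpha\otimes\beta-\beta\otimes\alpha)$ for 1-forms; thus $\mathcal K(u,v)=\sum_{A,B}\mathbf K^c_{AB}V^A(u)V^B(v)$. **Theorem.** The solvable coordinates are a global parametrization: $\Upsilon\mapsto\mathbb L(\Upsilon)\mathrm H$ is a bijection $\mathbb R^d\to\mathrm U/\mathrm H$. For every $J\in\mathbb U$ the derivative defining $\mathfrak k_J$ exists at every point, and the function $$\mathfrak P_J(\Upsilon)=\tfrac12\,\mathrm{Tr}\big[X_c\,\mathbb L(\Upsilon)^{-1}J\,\mathbb L(\Upsilon)\big]$$ is smooth on all of $\mathbb R^d$ and is a moment map for $\mathfrak k_J$: $$i_{\mathfrak k_J}\mathcal K=d\mathfrak P_J\quad\text{on all of }\mathbb R^d,\qquad\text{i.e. } \mathcal K(\mathfrak k_J,v)=d\mathfrak P_J(v)\ \text{ for all tangent vectors } v.$$ -/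

import Mathlib

open scoped Matrix ContDiff

attribute [local instance] LieRing.ofAssociativeRing

noncomputable section

/-- Real square matrices of size `N`. -/
abbrev Mat (N : ℕ) : Type := Matrix (Fin N) (Fin N) ℝ

/-- The matrix exponential, as an invertible matrix. -/
def expGL {N : ℕ} (X : Mat N) : GL (Fin N) ℝ := (Matrix.isUnit_exp X).unit

/-- A Kähler non-compact symmetric space `U/H` with `U` a semisimple group of real matrices,
given by its infinitesimal data. The Lie algebra `𝔲` is stable under transposition, so that
`X ↦ -Xᵀ` is a Cartan involution: `ℍ` consists of the antisymmetric elements of `𝔲`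
and `𝕂` of the symmetric ones. The element `Xc` generates the central `𝔰𝔬(2)` of `ℍ`, and its
adjoint action on `𝕂` is, up to normalization, a complex structure. -/
structure KahlerSymmetricSpace (N : ℕ) where
  /-- the Lie algebra of the isometry group `U` -/
  𝔲 : LieSubalgebra ℝ (Mat N)
  semisimple : LieAlgebra.IsSemisimple ℝ 𝔲
  transpose_mem : ∀ X ∈ 𝔲, Xᵀ ∈ 𝔲
  /-- the generator of the central `𝔰𝔬(2)` -/
  Xc : Mat N
  Xc_mem : Xc ∈ 𝔲
  Xc_compact : Xcᵀ = -Xc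
  Xc_central : ∀ Y ∈ 𝔲, Yᵀ = -Y → ⁅Xc, Y⁆ = 0
  Xc_complex : ∃ c : ℝ, c ≠ 0 ∧ ∀ Y ∈ 𝔲, Yᵀ = Y → ⁅Xc, ⁅Xc, Y⁆⁆ = -(c ^ 2) • Y

namespace KahlerSymmetricSpace

variable {N : ℕ} (S : KahlerSymmetricSpace N)

/-- The compact part `ℍ` of `𝔲`: its antisymmetric matrices. -/
def ℍ : Submodule ℝ (Mat N) where
  carrier := {X | X ∈ S.𝔲 ∧ Xᵀ = -X}
  add_mem' := by
    rintro a b ⟨ha, ha'⟩ ⟨hb, hb'⟩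
    exact ⟨add_mem ha hb, by rw [Matrix.transpose_add, ha', hb', neg_add]⟩
  zero_mem' := ⟨zero_mem _, by simp⟩
  smul_mem' := by
    rintro c a ⟨ha, ha'⟩
    exact ⟨S.𝔲.smul_mem c ha, by rw [Matrix.transpose_smul, ha', smul_neg]⟩

/-- The non-compact part `𝕂` of `𝔲`: its symmetric matrices. -/
def 𝕂 : Submodule ℝ (Mat N) where
  carrier := {X | X ∈ S.𝔲 ∧ Xᵀ = X}
  add_mem' := by
    rintro a b ⟨ha, ha'⟩ ⟨hb, hb'⟩
    exact ⟨add_mem ha hb, by rw [Matrix.transpose_add, ha', hb']⟩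
  zero_mem' := ⟨zero_mem _, by simp⟩
  smul_mem' := by
    rintro c a ⟨ha, ha'⟩
    exact ⟨S.𝔲.smul_mem c ha, by rw [Matrix.transpose_smul, ha']⟩

/-- The connected matrix group `U` with Lie algebra `𝔲`, generated by the exponentials. -/
def U : Subgroup (GL (Fin N) ℝ) := Subgroup.closure {g | ∃ X ∈ S.𝔲, g = expGL X}

/-- The compact subgroup `H` of `U`: its orthogonal matrices. -/
def H : Subgroup S.U := (Matrix.orthogonalGroup (Fin N) ℝ).units.subgroupOf S.U

/-- The element `exp X` of `U`, for `X ∈ 𝔲`. -/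
def expU (X : S.𝔲) : S.U :=
  ⟨expGL (X : Mat N), Subgroup.subset_closure ⟨X, X.2, rfl⟩⟩

/-- A basis of the solvable Lie algebra of `U/H` in the triangular basis: the first `r` generators
are the (diagonal) non-compact Cartan generators, the others are strictly upper triangular
root vectors for positive restricted roots, and `𝔲 = ℍ + Solv`. -/
structure SolvableBasis (d r : ℕ) where
  /-- the generators of the solvable Lie algebra -/
  T : Fin d → Mat N
  mem : ∀ A, T A ∈ S.𝔲
  linearIndependent : LinearIndependent ℝ T
  lie_mem : ∀ A B, ⁅T A, T B⁆ ∈ Submodule.span ℝ (Set.range T)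
  sup_eq : S.ℍ ⊔ Submodule.span ℝ (Set.range T) = S.𝔲.toSubmodule
  disjoint : Disjoint S.ℍ (Submodule.span ℝ (Set.range T))
  cartan_diag : ∀ A : Fin d, (A : ℕ) < r → (T A).IsDiag
  nilpotent_upper : ∀ A : Fin d, r ≤ (A : ℕ) → ∀ i j, j ≤ i → T A i j = 0
  root_vector : ∀ A B : Fin d, r ≤ (A : ℕ) → (B : ℕ) < r → ∃ c : ℝ, ⁅T B, T A⁆ = c • T A
  positive : ∃ h ∈ Submodule.span ℝ {X | ∃ B : Fin d, (B : ℕ) < r ∧ X = T B},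
    ∀ A : Fin d, r ≤ (A : ℕ) → ∃ c : ℝ, 0 < c ∧ ⁅h, T A⁆ = c • T A

namespace SolvableBasis

variable {S} {d r : ℕ} (b : S.SolvableBasis d r)

/-- The solvable coset representative, as an element of `U`:
`𝕃(Υ) = exp(Υ¹ T₁) exp(Υ² T₂) ⋯ exp(Υᵈ T_d)`, in this order. -/
def rep (Υ : Fin d → ℝ) : S.U :=
  (List.ofFn fun A => S.expU ⟨Υ A • b.T A, S.𝔲.smul_mem (Υ A) (b.mem A)⟩).prod

/-- The solvable coset representative `𝕃(Υ)`, as a matrix. -/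
def 𝕃 (Υ : Fin d → ℝ) : Mat N := ((b.rep Υ : GL (Fin N) ℝ) : Mat N)

/-- The point of `U/H` with solvable coordinates `Υ`. -/
def point (Υ : Fin d → ℝ) : S.U ⧸ S.H := (b.rep Υ : S.U ⧸ S.H)

/-- The action of `g ∈ U` on `U/H` in solvable coordinates: `g(Υ)` is determined by
`g 𝕃(Υ) ∈ 𝕃(g(Υ)) H`. -/
def act (g : S.U) (Υ : Fin d → ℝ) : Fin d → ℝ := Function.invFun b.point (g • b.point Υ)

/-- The Killing vector field of `J ∈ 𝔲`, in components with respect to `∂/∂Υ^α`: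
the velocity at `θ = 0` of `θ ↦ exp(θ J)(Υ)`. -/
def killing (J : S.𝔲) (Υ : Fin d → ℝ) : Fin d → ℝ :=
  deriv (fun θ : ℝ => b.act (S.expU (θ • J)) Υ) 0

/-- The left-invariant matrix 1-form `Θ = 𝕃⁻¹ d𝕃`, at `Υ` on the tangent vector `v`. -/
def Θ (Υ v : Fin d → ℝ) : Mat N :=
  (b.𝕃 Υ)⁻¹ * Matrix.of fun i j => fderiv ℝ (fun Υ' => b.𝕃 Υ' i j) Υ v

/-- The vielbein 1-forms `V^A = Tr (Θ K^A)`. -/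
def V (K : Fin d → Mat N) (A : Fin d) (Υ v : Fin d → ℝ) : ℝ := (b.Θ Υ v * K A).trace

end SolvableBasis

/-- `K` is a basis of `𝕂`, orthonormal for the trace form. -/
structure IsOrthonormalBasis {d : ℕ} (K : Fin d → Mat N) : Prop where
  span_eq : Submodule.span ℝ (Set.range K) = S.𝕂
  trace_mul : ∀ A B, (K A * K B).trace = if A = B then 1 else 0

/-- The matrix of the adjoint action of `Xc` on `𝕂`:
`Kᶜ_AB = ½ Tr ([Xc, K_A] K_B)`. -/
def Kc {d : ℕ} (K : Fin d → Mat N) (A B : Fin d) : ℝ := (1 / 2) * (⁅S.Xc, K A⁆ * K B).trace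

end KahlerSymmetricSpace

/-- The wedge product of two 1-forms `α, β` at a point, with the normalization
`α ∧ β = ½ (α ⊗ β - β ⊗ α)`, for which the 2-form `ω_AB e^A ∧ e^B` with antisymmetric
coefficients has components `ω_AB`. -/
def wedge {E : Type*} (α β : E → ℝ) (u v : E) : ℝ := (1 / 2) * (α u * β v - β u * α v)

namespace KahlerSymmetricSpace.SolvableBasis

variable {N : ℕ} {S : KahlerSymmetricSpace N} {d r : ℕ} (b : S.SolvableBasis d r)

/-- The Kähler 2-form `𝒦 = Σ_{A,B} Kᶜ_AB V^A ∧ V^B`, at `Υ` on the tangent vectors `u, v`. -/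
def 𝒦 (K : Fin d → Mat N) (Υ u v : Fin d → ℝ) : ℝ :=
  ∑ A, ∑ B, S.Kc K A B * wedge (b.V K A Υ) (b.V K B Υ) u v

/-- The function `𝔓_J(Υ) = ½ Tr (Xc 𝕃(Υ)⁻¹ J 𝕃(Υ))`. -/
def 𝔓 (J : S.𝔲) (Υ : Fin d → ℝ) : ℝ :=
  (1 / 2) * (S.Xc * (b.𝕃 Υ)⁻¹ * (J : Mat N) * b.𝕃 Υ).trace

end KahlerSymmetricSpace.SolvableBasis

end

/-! By `coset_eq_iff`, the map `gH ↦ g gᵀ` embeds `U/H` into the symmetric matrices, so every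
statement about cosets becomes one about `E Eᵀ`, where `E = expProd b.T Υ` is the coset
representative.

Injectivity: `E` is upper triangular with positive diagonal, so uniqueness in the Cholesky
decomposition recovers `E` from `E Eᵀ`. The diagonal of `E` determines the Cartan parameters.
Conjugation by `exp (s h)` with `s → -∞` contracts the nilpotent parameters into a neighbourhood of
the origin, where `E` is controlled by its derivative. The same contraction shows that `E` is an
immersion and that the parametrization is proper (`exists_bound`).

Surjectivity: since `𝔲 = ℍ ⊕ Solv`, the field `E ↦ J E` projects to a `C¹` vector field on `ℝᵈ`.
Along an integral curve `α`, the element `g = exp (-tJ) E(α t)` satisfies `g' = g η` with `η ∈ ℍ`,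
so `g gᵀ` is constant (`exists_local_flow`). Hence the times at which the orbit of `exp (tJ)` lies
in the chart form an open set. Properness makes this set closed, so it is all of `ℝ`, and the
exponentials generate `U`.

Moment map: the initial velocity of this flow is the Killing field `k`, and its construction gives
`Θ(k) ≡ 𝕃⁻¹ J 𝕃` modulo `ℍ`. Differentiating the trace gives `d𝔓_J(v) = ½ Tr ([Xc, 𝕃⁻¹ J 𝕃] Θ(v))`
(`fderiv_𝔓`). The form `𝒦(k, v)` is the same expression with the second bracket entry and `Θ(v)`
replaced by symmetric parts. This changes nothing, because `Xc` commutes with `ℍ`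
(`trace_lie_symm_part`, `𝒦_eq`). -/

/-! ### Ordered products of exponentials: smoothness, adjoint stability, behaviour near the origin.
-/

section ExpProd

set_option linter.unusedSectionVars false

open NormedSpace

variable {𝔸 : Type*} [NormedRing 𝔸] [NormedAlgebra ℝ 𝔸] {n : ℕ}

/-- The ordered product `exp (c₀ T₀) exp (c₁ T₁) ⋯`. -/
noncomputable def expProd (T : Fin n → 𝔸) (c : Fin n → ℝ) : 𝔸 :=
  (List.ofFn fun i => exp (c i • T i)).prod

theorem expProd_succ (T : Fin (n + 1) → 𝔸) (c : Fin (n + 1) → ℝ) :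
    expProd T c = exp (c 0 • T 0) * expProd (fun i => T i.succ) (fun i => c i.succ) := by
  simp [expProd, List.ofFn_succ]

theorem expProd_of_dim_zero (T : Fin 0 → 𝔸) (c : Fin 0 → ℝ) : expProd T c = 1 := by
  simp [expProd]

theorem expProd_zero (T : Fin n → 𝔸) : expProd T 0 = 1 := by
  simp [expProd]

variable [NormedAlgebra ℚ 𝔸] [CompleteSpace 𝔸]

theorem exp_mul_exp_neg (x : 𝔸) : exp x * exp (-x) = 1 := by
  rw [← exp_add_of_commute (Commute.refl x).neg_right, add_neg_cancel, exp_zero]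

theorem exp_neg_mul_exp (x : 𝔸) : exp (-x) * exp x = 1 := by
  simpa using exp_mul_exp_neg (-x)

theorem isUnit_expProd (T : Fin n → 𝔸) (c : Fin n → ℝ) : IsUnit (expProd T c) := by
  induction n with
  | zero => rw [expProd_of_dim_zero]; exact isUnit_one
  | succ n ih => rw [expProd_succ]; exact (isUnit_exp _).mul (ih _ _)

theorem contDiff_expProd (T : Fin n → 𝔸) : ContDiff ℝ ∞ (expProd T) := by
  have hexp : ContDiff ℝ ∞ (fun X : 𝔸 => exp X) :=
    contDiff_iff_contDiffAt.2 fun x => (exp_analytic (𝕂 := ℝ) x).contDiffAt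
  -- The reindexing `σ` keeps the parameter space `Fin m → ℝ` fixed while the induction shortens the
  -- product.
  have key : ∀ {n m : ℕ} (T : Fin n → 𝔸) (σ : Fin n → Fin m),
      ContDiff ℝ ∞ (fun c : Fin m → ℝ => expProd T (fun i => c (σ i))) := by
    intro n m T σ
    induction n with
    | zero => simp only [expProd_of_dim_zero]; exact contDiff_const
    | succ n ih =>
      simp only [expProd_succ]
      exact (hexp.comp ((contDiff_apply ℝ ℝ (σ 0)).smul contDiff_const)).mul (ih _ _)
  exact key T id

theorem contDiff_inverse_expProd (T : Fin n → 𝔸) :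
    ContDiff ℝ ∞ (fun c => Ring.inverse (expProd T c)) := by
  refine contDiff_iff_contDiffAt.2 fun c => ?_
  obtain ⟨u, hu⟩ := isUnit_expProd T c
  have h := contDiffAt_ringInverse (n := ∞) ℝ u
  rw [hu] at h
  exact h.comp c (contDiff_expProd T).contDiffAt

theorem hasDerivAt_expProd_zero (T : Fin n → 𝔸) (v : Fin n → ℝ) :
    HasDerivAt (fun t : ℝ => expProd T (t • v)) (∑ i, v i • T i) 0 := by
  induction n with
  | zero => simpa [expProd_of_dim_zero] using hasDerivAt_const (0 : ℝ) (1 : 𝔸)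
  | succ n ih =>
    have h := ih (fun i => T i.succ) (fun i => v i.succ)
    have h0 : HasDerivAt (fun s : ℝ => exp (s • v 0 • T 0)) (v 0 • T 0) 0 := by
      simpa using hasDerivAt_exp_smul_const (v 0 • T 0) (0 : ℝ)
    have h1 := h0.mul h
    have hz := expProd_zero fun i : Fin n => T i.succ
    have hf : (fun t : ℝ => expProd T (t • v)) = (fun s : ℝ => exp (s • v 0 • T 0)) *
        fun t : ℝ => expProd (fun i : Fin n => T i.succ) (t • fun i => v i.succ) := by
      funext s
      simp [expProd_succ, smul_smul]
      rfl
    rw [hf, Fin.sum_univ_succ]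
    simpa [hz] using h1

variable [FiniteDimensional ℝ 𝔸]

/-- A subspace stable under `ad x` is stable under `Ad (exp x)`. -/
theorem exp_conj_mem (W : Submodule ℝ 𝔸) (x : 𝔸)
    (hx : ∀ y ∈ W, x * y - y * x ∈ W) {y : 𝔸} (hy : y ∈ W) :
    exp x * y * exp (-x) ∈ W := by
  let D : 𝔸 →L[ℝ] 𝔸 := ContinuousLinearMap.mul ℝ 𝔸 x - (ContinuousLinearMap.mul ℝ 𝔸).flip x
  have hD : ∀ z, D z = x * z - z * x := fun z => rfl
  let s : Subalgebra ℝ (𝔸 →L[ℝ] 𝔸) :=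
    { carrier := {A | ∀ z ∈ W, A z ∈ W}
      mul_mem' := fun ha hb z hz => ha _ (hb _ hz)
      add_mem' := fun ha hb z hz => add_mem (ha _ hz) (hb _ hz)
      algebraMap_mem' := fun c z hz => W.smul_mem c hz }
  have hs : IsClosed (s : Set (𝔸 →L[ℝ] 𝔸)) :=
    (Subalgebra.toSubmodule s).closed_of_finiteDimensional
  have hmem : exp D y ∈ W :=
    (NormedSpace.exp_mem (R := ℝ) hs (x := D) (fun z hz => by rw [hD]; exact hx z hz)) y hy
  -- Constancy of this curve gives `exp (ad x) y = exp x * y * exp (-x)`, and the left side already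
  -- lies in `W`.
  have hexp : ∀ t : ℝ, HasDerivAt
      (fun t : ℝ => exp (t • (-x)) * (exp (t • D) y) * exp (t • x)) 0 t := by
    intro t
    have h1 := hasDerivAt_exp_smul_const (-x) t
    have h2 : HasDerivAt (fun t : ℝ => exp (t • D) y) (D (exp (t • D) y)) t :=
      (ContinuousLinearMap.apply ℝ 𝔸 y).hasFDerivAt.comp_hasDerivAt t
        (hasDerivAt_exp_smul_const' D t)
    have h3 := hasDerivAt_exp_smul_const' x t
    convert! (h1.mul h2).mul h3 using 1
    rw [hD]
    simp only [Pi.mul_apply]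
    noncomm_ring
  have hconst := is_const_of_deriv_eq_zero (fun t => (hexp t).differentiableAt)
    (fun t => (hexp t).deriv) 1 0
  have hzero : exp ((0 : ℝ) • D) y = y := by
    have : (0 : ℝ) • D = 0 := zero_smul ℝ D
    rw [this, exp_zero]
    rfl
  simp only [hzero, one_smul, zero_smul, exp_zero, one_mul, mul_one] at hconst
  rw [← hconst]
  convert hmem using 1
  calc exp x * (exp (-x) * exp D y * exp x) * exp (-x)
      = (exp x * exp (-x)) * exp D y * (exp x * exp (-x)) := by noncomm_ring
    _ = exp D y := by rw [exp_mul_exp_neg]; simp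

/-- A subspace stable under the adjoint action of the generators is stable under the adjoint
action of the inverse of an ordered product of their exponentials. -/
theorem expProd_conj_mem (T : Fin n → 𝔸) (W : Submodule ℝ 𝔸)
    (hW : ∀ i, ∀ y ∈ W, T i * y - y * T i ∈ W)
    (c : Fin n → ℝ) {y : 𝔸} (hy : y ∈ W) :
    Ring.inverse (expProd T c) * y * expProd T c ∈ W := by
  induction n generalizing y with
  | zero => simpa [expProd_of_dim_zero] using hy
  | succ n ih =>
    rw [expProd_succ, Ring.inverse_mul (Or.inl (isUnit_exp _)), Ring.inverse_exp]
    have h1 := ih (fun i => T i.succ) (fun i => hW i.succ) (fun i => c i.succ)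
      (y := exp (-(c 0 • T 0)) * y * exp (c 0 • T 0)) (by
        have := exp_conj_mem W (-(c 0 • T 0)) (fun z hz => by
          have := W.smul_mem (-c 0) (hW 0 z hz)
          convert this using 1
          simp [smul_sub, neg_add_eq_sub]) hy
        simpa using this)
    convert h1 using 1
    noncomm_ring

/-- The Maurer–Cartan form of an ordered product of exponentials takes values in every
subspace that contains the generators and is stable under their adjoint action. -/
theorem exists_mem_hasDerivAt_expProd (T : Fin n → 𝔸) (W : Submodule ℝ 𝔸)
    (hT : ∀ i, T i ∈ W) (hW : ∀ i, ∀ y ∈ W, T i * y - y * T i ∈ W)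
    (c : ℝ → Fin n → ℝ) (c' : Fin n → ℝ) (t : ℝ)
    (hc : ∀ i, HasDerivAt (fun s => c s i) (c' i) t) :
    ∃ θ ∈ W, HasDerivAt (fun s => expProd T (c s)) (expProd T (c t) * θ) t := by
  induction n with
  | zero => exact ⟨0, W.zero_mem, by simpa [expProd_of_dim_zero] using hasDerivAt_const t (1 : 𝔸)⟩
  | succ n ih =>
    obtain ⟨θ, hθ, h⟩ := ih (fun i => T i.succ) (fun i => hT i.succ) (fun i => hW i.succ)
      (fun s i => c s i.succ) (fun i => c' i.succ) (fun i => hc i.succ)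
    set Q := expProd (fun i => T i.succ) (fun i => c t i.succ) with hQ
    refine ⟨Ring.inverse Q * (c' 0 • T 0) * Q + θ, add_mem (expProd_conj_mem _ _
      (fun i => hW i.succ) _ (W.smul_mem _ (hT 0))) hθ, ?_⟩
    have h0 : HasDerivAt (fun s => exp (c s 0 • T 0)) (c' 0 • (exp (c t 0 • T 0) * T 0)) t :=
      HasDerivAt.scomp (g₁ := fun u : ℝ => exp (u • T 0)) t
        (hasDerivAt_exp_smul_const (T 0) (c t 0)) (hc 0)
    simp only [expProd_succ]
    convert! h0.mul h using 1
    rw [← hQ, mul_add]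
    have : exp (c t 0 • T 0) * Q * (Ring.inverse Q * (c' 0 • T 0) * Q)
        = exp (c t 0 • T 0) * (Q * Ring.inverse Q) * (c' 0 • T 0) * Q := by noncomm_ring
    rw [this, Ring.mul_inverse_cancel _ (isUnit_expProd _ _)]
    simp [mul_assoc]

theorem fderiv_expProd_mem (T : Fin n → 𝔸) (W : Submodule ℝ 𝔸)
    (hT : ∀ i, T i ∈ W) (hW : ∀ i, ∀ y ∈ W, T i * y - y * T i ∈ W) (c v : Fin n → ℝ) :
    Ring.inverse (expProd T c) * fderiv ℝ (expProd T) c v ∈ W := by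
  have hc : HasDerivAt (fun s : ℝ => c + s • v) v 0 := by
    simpa using ((hasDerivAt_id (0 : ℝ)).smul_const v).const_add c
  obtain ⟨θ, hθ, h⟩ := exists_mem_hasDerivAt_expProd T W hT hW (fun s => c + s • v) v 0
    (hasDerivAt_pi.1 hc)
  have hd : HasFDerivAt (expProd T) (fderiv ℝ (expProd T) c) (c + (0 : ℝ) • v) := by
    rw [zero_smul, add_zero]
    exact ((contDiff_expProd T).differentiable (by simp) c).hasFDerivAt
  have h2 := hd.comp_hasDerivAt (0 : ℝ) hc
  have h3 := h2.unique h
  rw [h3, zero_smul, add_zero, ← mul_assoc, Ring.inverse_mul_cancel _ (isUnit_expProd _ _), one_mul]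
  exact hθ

theorem fderiv_expProd_zero (T : Fin n → 𝔸) (v : Fin n → ℝ) :
    fderiv ℝ (expProd T) 0 v = ∑ i, v i • T i := by
  have hc : HasDerivAt (fun s : ℝ => s • v) v 0 := by
    simpa using (hasDerivAt_id (0 : ℝ)).smul_const v
  have hd : HasFDerivAt (expProd T) (fderiv ℝ (expProd T) 0) ((0 : ℝ) • v) := by
    rw [zero_smul]
    exact ((contDiff_expProd T).differentiable (by simp) 0).hasFDerivAt
  have h := hd.comp_hasDerivAt (0 : ℝ) hc
  exact h.unique (hasDerivAt_expProd_zero T v)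

/-- `W` is a non-unital algebra, closed because it is finite-dimensional, so it contains the
exponential series without its constant term. Applied to strictly triangular matrices, this produces
unipotent ones. -/
theorem exp_sub_one_mem (W : Submodule ℝ 𝔸) (hW : ∀ x ∈ W, ∀ y ∈ W, x * y ∈ W)
    {x : 𝔸} (hx : x ∈ W) : exp x - 1 ∈ W := by
  have h := exp_series_hasSum_exp' (𝕂 := ℝ) x
  rw [← hasSum_nat_add_iff' 1] at h
  simp only [Finset.range_one, Finset.sum_singleton, Nat.factorial_zero, Nat.cast_one, inv_one,
    pow_zero, one_smul] at h
  have hp : ∀ n : ℕ, x ^ (n + 1) ∈ W := by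
    intro n
    induction n with
    | zero => simpa using hx
    | succ n ih => rw [pow_succ]; exact hW _ ih _ hx
  exact W.closed_of_finiteDimensional.mem_of_tendsto h
    (Filter.Eventually.of_forall fun s =>
      Submodule.sum_mem _ fun n _ => Submodule.smul_mem _ _ (hp n))

theorem expProd_sub_one_mem (W : Submodule ℝ 𝔸) (hW : ∀ x ∈ W, ∀ y ∈ W, x * y ∈ W)
    (T : Fin n → 𝔸) (c : Fin n → ℝ) (hT : ∀ i, c i • T i ∈ W) : expProd T c - 1 ∈ W := by
  induction n with
  | zero => simp [expProd_of_dim_zero]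
  | succ n ih =>
    rw [expProd_succ]
    have h1 := exp_sub_one_mem W hW (hT 0)
    have h2 := ih (fun i => T i.succ) (fun i => c i.succ) (fun i => hT i.succ)
    set a := exp (c 0 • T 0)
    set b := expProd (fun i => T i.succ) (fun i => c i.succ)
    have : a * b - 1 = (a - 1) * (b - 1) + (a - 1) + (b - 1) := by noncomm_ring
    rw [this]
    exact add_mem (add_mem (hW _ h1 _ h2) h1) h2

/-- Rescaling the parameters amounts to conjugating by `D`, one factor at a time. -/
theorem expProd_scale (T : Fin n → 𝔸) (c c' : Fin n → ℝ) (D : 𝔸)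
    (hD : ∀ i, D * (c i • T i) = (c' i • T i) * D) : D * expProd T c = expProd T c' * D := by
  induction n with
  | zero => simp [expProd_of_dim_zero]
  | succ n ih =>
    have h0 : D * exp (c 0 • T 0) = exp (c' 0 • T 0) * D := SemiconjBy.exp_right (hD 0)
    have h1 := ih (fun i => T i.succ) (fun i => c i.succ) (fun i => c' i.succ) (fun i => hD i.succ)
    rw [expProd_succ, expProd_succ, ← mul_assoc, h0, mul_assoc, h1, mul_assoc]

/-- Factors that commute with everything to their left can be split off an ordered product. -/
theorem expProd_add (T : Fin n → 𝔸) (c s : Fin n → ℝ)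
    (hs : ∀ i j, j ≤ i → s i ≠ 0 → Commute (T i) (T j)) :
    expProd T (c + s) = exp (∑ i, s i • T i) * expProd T c := by
  induction n with
  | zero => simp [expProd_of_dim_zero]
  | succ n ih =>
    have h1 := ih (fun i => T i.succ) (fun i => c i.succ) (fun i => s i.succ)
      (fun i j hij hi => hs i.succ j.succ (Fin.succ_le_succ_iff.2 hij) hi)
    have hcomm : Commute (∑ i : Fin n, s i.succ • T i.succ) (T 0) := by
      refine Commute.sum_left _ _ _ fun i _ => ?_
      by_cases h : s i.succ = 0
      · simp [h]
      · exact (hs i.succ 0 (Fin.zero_le _) h).smul_left _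
    have h1' : expProd (fun i => T i.succ) (fun i => (c + s) i.succ)
        = exp (∑ i : Fin n, s i.succ • T i.succ)
          * expProd (fun i => T i.succ) (fun i => c i.succ) := h1
    have e0 : exp ((c + s) 0 • T 0) = exp (s 0 • T 0) * exp (c 0 • T 0) := by
      rw [← exp_add_of_commute (((Commute.refl (T 0)).smul_left _).smul_right _), ← add_smul,
        Pi.add_apply, add_comm]
    have e1 : exp (c 0 • T 0) * exp (∑ i : Fin n, s i.succ • T i.succ)
        = exp (∑ i : Fin n, s i.succ • T i.succ) * exp (c 0 • T 0) :=
      (hcomm.symm.smul_left (c 0)).exp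
    rw [expProd_succ, expProd_succ, h1', e0, Fin.sum_univ_succ,
      exp_add_of_commute (hcomm.symm.smul_left (s 0))]
    calc _ = exp (s 0 • T 0) * (exp (c 0 • T 0) * exp (∑ i : Fin n, s i.succ • T i.succ))
          * expProd (fun i => T i.succ) (fun i => c i.succ) := by noncomm_ring
      _ = _ := by rw [e1]; noncomm_ring

/-- Near the origin, an ordered product of exponentials of linearly independent elements is an
injective immersion. -/
theorem exists_ball_expProd_injective_immersion (T : Fin n → 𝔸) (hT : LinearIndependent ℝ T) :
    ∃ ε : ℝ, 0 < ε ∧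
      (∀ x ∈ Metric.ball 0 ε, ∀ y ∈ Metric.ball 0 ε, expProd T x = expProd T y → x = y) ∧
      ∀ x ∈ Metric.ball 0 ε, ∀ v, fderiv ℝ (expProd T) x v = 0 → v = 0 := by
  obtain ⟨q, hq⟩ := (Fintype.linearCombination ℝ T).exists_leftInverse_of_injective
    (LinearMap.ker_eq_bot.2 (linearIndependent_iff_injective_fintypeLinearCombination.1 hT))
  have hq' : ∀ v : Fin n → ℝ, q (∑ i, v i • T i) = v := fun v => LinearMap.congr_fun hq v
  let Q : 𝔸 →L[ℝ] (Fin n → ℝ) := q.toContinuousLinearMap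
  -- Composing with a left inverse of the linearization at the origin gives a self-map of `ℝⁿ` with
  -- derivative the identity at `0`. Closeness to the identity then yields both claims.
  let f : (Fin n → ℝ) → (Fin n → ℝ) := fun x => Q (expProd T x)
  have hf : ContDiff ℝ ∞ f := Q.contDiff.comp (contDiff_expProd T)
  have hfd : ∀ x, fderiv ℝ f x = Q.comp (fderiv ℝ (expProd T) x) := fun x =>
    (Q.hasFDerivAt.comp x ((contDiff_expProd T).differentiable (by simp) x).hasFDerivAt).fderiv
  have hf0 : fderiv ℝ f 0 = ContinuousLinearMap.id ℝ _ := by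
    ext1 v
    rw [hfd]
    simp only [ContinuousLinearMap.comp_apply, fderiv_expProd_zero]
    exact hq' v
  have hstrict : HasStrictFDerivAt f (ContinuousLinearMap.id ℝ (Fin n → ℝ)) 0 := by
    rw [← hf0]
    exact hf.contDiffAt.hasStrictFDerivAt (by simp)
  obtain ⟨s, hs, happ⟩ := hstrict.approximates_deriv_on_nhds (c := 1 / 2) (Or.inr (by norm_num))
  have hcont : Continuous (fderiv ℝ f) := hf.continuous_fderiv (by simp)
  have hnear : ∀ᶠ x in nhds (0 : Fin n → ℝ), ‖fderiv ℝ f x - fderiv ℝ f 0‖ < 1 := by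
    have := (hcont.sub continuous_const).norm.tendsto (x := (0 : Fin n → ℝ))
      (f := fun x => ‖fderiv ℝ f x - fderiv ℝ f 0‖)
    rw [sub_self, norm_zero] at this
    exact this.eventually (gt_mem_nhds one_pos)
  obtain ⟨ε, hε, hball⟩ := Metric.mem_nhds_iff.1 (Filter.inter_mem hs hnear)
  refine ⟨ε, hε, ?_, ?_⟩
  · intro x hx y hy hxy
    have h := happ x (hball hx).1 y (hball hy).1
    have hfe : f x = f y := congrArg Q hxy
    rw [hfe, sub_self, zero_sub, norm_neg] at h
    simp only [ContinuousLinearMap.id_apply] at h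
    have : ‖x - y‖ = 0 := by
      have h0 := norm_nonneg (x - y)
      norm_num at h
      linarith
    exact sub_eq_zero.1 (norm_eq_zero.1 this)
  · intro x hx v hv
    by_contra hne
    have h1 : ‖fderiv ℝ f x - fderiv ℝ f 0‖ < 1 := (hball hx).2
    have h2 : (fderiv ℝ f x - fderiv ℝ f 0) v = -v := by
      rw [hf0, hfd]; simp [hv]
    have h3 := (fderiv ℝ f x - fderiv ℝ f 0).le_opNorm v
    rw [h2, norm_neg] at h3
    have h4 : 0 < ‖v‖ := norm_pos_iff.2 hne
    nlinarith

end ExpProd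

/-! ### The flow of `J` projected to the parameters. -/

section Flow

set_option linter.unusedSectionVars false

open NormedSpace

variable {𝔸 : Type*} [NormedRing 𝔸] [NormedAlgebra ℝ 𝔸] [NormedAlgebra ℚ 𝔸] [CompleteSpace 𝔸]
  [FiniteDimensional ℝ 𝔸] {n : ℕ}

theorem stable_span_of_lie_mem {T : Fin n → 𝔸}
    (hlie : ∀ i j, T i * T j - T j * T i ∈ Submodule.span ℝ (Set.range T)) (i : Fin n) :
    ∀ y ∈ Submodule.span ℝ (Set.range T),
      T i * y - y * T i ∈ Submodule.span ℝ (Set.range T) := by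
  intro y hy
  induction hy using Submodule.span_induction with
  | mem x hx => obtain ⟨j, rfl⟩ := hx; exact hlie i j
  | zero => simp
  | add x y _ _ hx hy =>
    have : T i * (x + y) - (x + y) * T i = (T i * x - x * T i) + (T i * y - y * T i) := by
      noncomm_ring
    rw [this]; exact add_mem hx hy
  | smul a x _ hx =>
    have : T i * (a • x) - (a • x) * T i = a • (T i * x - x * T i) := by
      rw [smul_sub, mul_smul_comm, smul_mul_assoc]
    rw [this]; exact Submodule.smul_mem _ _ hx

/-- The vector field on the parameters of an immersive ordered product of exponentials which
projects the right-invariant field of `J`. -/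
theorem exists_contDiff_projected_field (T : Fin n → 𝔸)
    (hlie : ∀ i j, T i * T j - T j * T i ∈ Submodule.span ℝ (Set.range T))
    (himm : ∀ c v, fderiv ℝ (expProd T) c v = 0 → v = 0)
    (q : 𝔸 →ₗ[ℝ] (Fin n → ℝ)) (hq : ∀ v : Fin n → ℝ, q (∑ i, v i • T i) = v) (J : 𝔸) :
    ∃ F : (Fin n → ℝ) → (Fin n → ℝ), ContDiff ℝ 1 F ∧
      ∀ c, q (Ring.inverse (expProd T c) * fderiv ℝ (expProd T) c (F c))
        = q (Ring.inverse (expProd T c) * J * expProd T c) := by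
  let Q : 𝔸 →L[ℝ] (Fin n → ℝ) := q.toContinuousLinearMap
  let B : (Fin n → ℝ) → ((Fin n → ℝ) →L[ℝ] (Fin n → ℝ)) := fun c =>
    Q.comp ((ContinuousLinearMap.mul ℝ 𝔸 (Ring.inverse (expProd T c))).comp
      (fderiv ℝ (expProd T) c))
  have hB : ∀ c v, B c v = q (Ring.inverse (expProd T c) * fderiv ℝ (expProd T) c v) :=
    fun c v => rfl
  have hBsmooth : ContDiff ℝ 1 B := by
    refine contDiff_const.clm_comp (ContDiff.clm_comp ?_ ?_)
    · exact (ContinuousLinearMap.mul ℝ 𝔸).contDiff.comp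
        ((contDiff_inverse_expProd T).of_le (by simp))
    · exact (contDiff_expProd T).fderiv_right (m := 1) (by norm_num; exact WithTop.coe_le_coe.2 le_top)
  -- The Maurer–Cartan form takes values in the span of `T`, on which `q` is injective, so `B c`
  -- inherits injectivity from the immersion hypothesis. As an endomorphism of `ℝⁿ` it is then
  -- invertible, and the field is found by inverting it.
  have hBinj : ∀ c, Function.Injective (B c) := by
    intro c
    refine (injective_iff_map_eq_zero (B c)).2 fun v hv => himm c v ?_
    rw [hB] at hv
    have hmem := fderiv_expProd_mem T _ (fun i => Submodule.subset_span (Set.mem_range_self i))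
      (stable_span_of_lie_mem hlie) c v
    obtain ⟨w, hw⟩ := (Submodule.mem_span_range_iff_exists_fun ℝ).1 hmem
    rw [← hw, hq] at hv
    rw [hv] at hw
    have h0 : Ring.inverse (expProd T c) * fderiv ℝ (expProd T) c v = 0 := by
      rw [← hw]; simp
    have := congrArg (fun x => expProd T c * x) h0
    simpa [← mul_assoc, Ring.mul_inverse_cancel _ (isUnit_expProd T c)] using this
  have hBequiv : ∀ c, ∃ e : (Fin n → ℝ) ≃L[ℝ] (Fin n → ℝ), (e : _ →L[ℝ] _) = B c := by
    intro c
    refine ⟨(LinearEquiv.ofInjectiveEndo (B c).toLinearMap (hBinj c)).toContinuousLinearEquiv, ?_⟩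
    ext1 v
    rfl
  refine ⟨fun c => ContinuousLinearMap.inverse (B c)
    (q (Ring.inverse (expProd T c) * J * expProd T c)), ?_, ?_⟩
  · refine ContDiff.clm_apply ?_ ?_
    · refine contDiff_iff_contDiffAt.2 fun c => ?_
      obtain ⟨e, he⟩ := hBequiv c
      have h := contDiffAt_map_inverse (n := 1) e
      rw [he] at h
      exact h.comp c hBsmooth.contDiffAt
    · exact Q.contDiff.comp ((((contDiff_inverse_expProd T).of_le (by simp)).mul
        contDiff_const).mul ((contDiff_expProd T).of_le (by simp)))
  · intro c
    obtain ⟨e, he⟩ := hBequiv c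
    rw [← hB]
    simp only [← he, ContinuousLinearMap.inverse_equiv]
    simp

/-- The one-parameter group generated by `J` acts locally on the classes of an ordered product
of exponentials `E` modulo the fixed points of the involution `x ↦ τ x⁻¹`, these classes being
represented by `E * τ E`. -/
theorem exists_local_flow (T : Fin n → 𝔸)
    (hlie : ∀ i j, T i * T j - T j * T i ∈ Submodule.span ℝ (Set.range T))
    (himm : ∀ c v, fderiv ℝ (expProd T) c v = 0 → v = 0)
    (q : 𝔸 →ₗ[ℝ] (Fin n → ℝ)) (hq : ∀ v : Fin n → ℝ, q (∑ i, v i • T i) = v)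
    (τ : 𝔸 →ₗ[ℝ] 𝔸) (hτ : ∀ x y, τ (x * y) = τ y * τ x)
    (L : Submodule ℝ 𝔸) (hTL : ∀ i, T i ∈ L) (hL : ∀ i, ∀ y ∈ L, T i * y - y * T i ∈ L)
    (hLq : ∀ x ∈ L, q x = 0 → τ x = -x) {J : 𝔸} (hJ : J ∈ L) (c : Fin n → ℝ) :
    ∃ (α : ℝ → Fin n → ℝ) (v : Fin n → ℝ) (ε : ℝ), 0 < ε ∧ α 0 = c ∧ HasDerivAt α v 0 ∧
      q (Ring.inverse (expProd T c) * fderiv ℝ (expProd T) c v)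
        = q (Ring.inverse (expProd T c) * J * expProd T c) ∧
      ∀ t ∈ Set.Ioo (-ε) ε,
        exp (t • -J) * expProd T (α t) * τ (exp (t • -J) * expProd T (α t))
          = expProd T c * τ (expProd T c) := by
  obtain ⟨F, hF, hFq⟩ := exists_contDiff_projected_field T hlie himm q hq J
  obtain ⟨α, hα0, ε, hε, hα⟩ := (hF.contDiffAt (x := c)
    ).exists_forall_mem_closedBall_exists_eq_forall_mem_Ioo_hasDerivAt₀ 0
  simp only [zero_sub, zero_add] at hα
  refine ⟨α, F c, ε, hε, hα0, ?_, hFq c, ?_⟩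
  · have := hα 0 ⟨by linarith, hε⟩
    rwa [hα0] at this
  let g : ℝ → 𝔸 := fun t => exp (t • -J) * expProd T (α t)
  -- With `g' = g η` and `τ η = -η`, the two terms of the derivative of `g * τ g` cancel.
  have hg : ∀ t ∈ Set.Ioo (-ε) ε, HasDerivAt (fun t => g t * τ (g t)) 0 t := by
    intro t ht
    have hE := ((contDiff_expProd T).differentiable (by simp)
      (α t)).hasFDerivAt.comp_hasDerivAt t (hα t ht)
    have hgd := (hasDerivAt_exp_smul_const (-J) t).mul hE
    set R := Ring.inverse (expProd T (α t))
    set E := expProd T (α t)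
    have hER : E * R = 1 := Ring.mul_inverse_cancel _ (isUnit_expProd _ _)
    -- The choice of `F` makes `q η = 0`; here `τ` plays the role of transposition and `ker q ∩ L`
    -- that of `ℍ`.
    set η := R * fderiv ℝ (expProd T) (α t) (F (α t)) - R * J * E with hη
    have hηL : η ∈ L := sub_mem (fderiv_expProd_mem T L hTL hL _ _) (expProd_conj_mem T L hL _ hJ)
    have hτη : τ η = -η := hLq η hηL (by rw [hη, map_sub, hFq, sub_self])
    have hgd' : HasDerivAt g (g t * η) t := by
      convert! hgd using 1
      have : g t * η = exp (t • -J) * ((E * R) * fderiv ℝ (expProd T) (α t) (F (α t))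
          - (E * R) * J * E) := by
        rw [hη]; simp only [g]; noncomm_ring
      rw [this, hER]
      simp only [Function.comp]
      noncomm_ring
    have hτd : HasDerivAt (fun t => τ (g t)) (τ (g t * η)) t :=
      τ.toContinuousLinearMap.hasFDerivAt.comp_hasDerivAt t hgd'
    convert! hgd'.mul hτd using 1
    rw [hτ (g t) η, hτη]
    noncomm_ring
  intro t ht
  have hconst := IsOpen.is_const_of_deriv_eq_zero (𝕜 := ℝ) isOpen_Ioo (convex_Ioo (-ε) ε).isPreconnected
    (fun t ht => (hg t ht).differentiableAt.differentiableWithinAt) (fun t ht => (hg t ht).deriv)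
    ht (show (0 : ℝ) ∈ Set.Ioo (-ε) ε from ⟨by linarith, hε⟩)
  simpa [g, hα0] using hconst

end Flow

/-! ### Contraction by weighted dilations: from local to global injectivity and immersion. -/

section Scaling

set_option linter.unusedSectionVars false

open NormedSpace Filter

variable {n : ℕ}

/-- The weighted dilation `x ↦ (exp (s wᵢ) xᵢ)ᵢ`. -/
noncomputable def dilation (w : Fin n → ℝ) (s : ℝ) (x : Fin n → ℝ) : Fin n → ℝ :=
  fun i => Real.exp (s * w i) * x i

/-- The part of a vector of weight zero. -/
noncomputable def weightZeroPart (w x : Fin n → ℝ) : Fin n → ℝ :=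
  fun i => if w i = 0 then x i else 0

theorem sub_weightZeroPart_apply {w : Fin n → ℝ} (x : Fin n → ℝ) {i : Fin n} (hi : w i = 0) :
    (x - weightZeroPart w x) i = 0 := by
  simp [weightZeroPart, hi]

theorem continuous_dilation (w : Fin n → ℝ) (x : Fin n → ℝ) :
    Continuous (fun s => dilation w s x) := by
  unfold dilation
  fun_prop

theorem tendsto_dilation_atBot {w : Fin n → ℝ} (hw : ∀ i, 0 ≤ w i) {x : Fin n → ℝ}
    (hx : ∀ i, w i = 0 → x i = 0) : Tendsto (fun s => dilation w s x) atBot (nhds 0) := by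
  refine tendsto_pi_nhds.2 fun i => ?_
  rcases (hw i).eq_or_lt with h | h
  · simp [dilation, hx i h.symm]
  · have h1 : Tendsto (fun s : ℝ => Real.exp (s * w i)) atBot (nhds 0) :=
      Real.tendsto_exp_atBot.comp (tendsto_id.atBot_mul_const h)
    simpa [dilation] using h1.mul_const (x i)

theorem dilation_injective (w : Fin n → ℝ) (s : ℝ) : Function.Injective (dilation w s) := by
  intro x y h
  funext i
  exact mul_left_cancel₀ (Real.exp_pos _).ne' (congrFun h i)

variable {𝔸 : Type*} [NormedRing 𝔸] [NormedAlgebra ℝ 𝔸] [NormedAlgebra ℚ 𝔸] [CompleteSpace 𝔸]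
  [FiniteDimensional ℝ 𝔸]

/-- A family of generators which are homogeneous of nonnegative weight `w` for a one-parameter
family of conjugations by units `D s`, those of weight zero commuting with the preceding ones. -/
structure IsHomogeneousFamily (T : Fin n → 𝔸) (w : Fin n → ℝ) (D : ℝ → 𝔸) : Prop where
  linearIndependent : LinearIndependent ℝ T
  nonneg : ∀ i, 0 ≤ w i
  isUnit : ∀ s, IsUnit (D s)
  semiconj : ∀ s i, D s * T i = (Real.exp (s * w i) • T i) * D s
  commute : ∀ i j, j ≤ i → w i = 0 → Commute (T i) (T j)

namespace IsHomogeneousFamily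

variable {T : Fin n → 𝔸} {w : Fin n → ℝ} {D : ℝ → 𝔸} (hT : IsHomogeneousFamily T w D)
include hT

theorem expProd_dilation (s : ℝ) (x : Fin n → ℝ) :
    D s * expProd T x = expProd T (dilation w s x) * D s := by
  refine expProd_scale T x _ (D s) fun i => ?_
  rw [mul_smul_comm, hT.semiconj, dilation, mul_comm (Real.exp _), mul_smul, smul_mul_assoc,
    smul_mul_assoc, smul_mul_assoc]

theorem expProd_eq (c y : Fin n → ℝ) :
    expProd T y = exp (∑ i, weightZeroPart w c i • T i) * expProd T (y - weightZeroPart w c) := by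
  have := expProd_add T (y - weightZeroPart w c) (weightZeroPart w c) fun i j hij hi =>
    hT.commute i j hij (by by_contra h; simp [weightZeroPart, h] at hi)
  rwa [sub_add_cancel] at this

/-- After cancelling the common weight-zero factor, a dilation with `s` very negative moves both
parameter vectors into the ball of local injectivity. Conjugation by `D s` transports the equality
there. -/
theorem expProd_injective {x y : Fin n → ℝ} (hxy : ∀ i, w i = 0 → x i = y i)
    (h : expProd T x = expProd T y) : x = y := by
  obtain ⟨ε, hε, hinj, -⟩ := exists_ball_expProd_injective_immersion T hT.linearIndependent
  have hz : weightZeroPart w y = weightZeroPart w x := by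
    funext i
    unfold weightZeroPart
    split_ifs with hi
    · exact (hxy i hi).symm
    · rfl
  rw [hT.expProd_eq x x, hT.expProd_eq x y] at h
  have h' := (isUnit_exp (∑ i, weightZeroPart w x i • T i)).mul_left_cancel h
  have hx := tendsto_dilation_atBot hT.nonneg
    (fun i hi => sub_weightZeroPart_apply x hi)
  have hy := tendsto_dilation_atBot hT.nonneg
    (fun i hi => sub_weightZeroPart_apply y hi)
  rw [hz] at hy
  obtain ⟨s, hsx, hsy⟩ := ((hx.eventually (Metric.ball_mem_nhds 0 hε)).and
    (hy.eventually (Metric.ball_mem_nhds 0 hε))).exists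
  have hd := dilation_injective w s (hinj _ hsx _ hsy ((hT.isUnit s).mul_right_cancel (by
    rw [← hT.expProd_dilation, ← hT.expProd_dilation, h'])))
  exact sub_left_injective hd

theorem expProd_immersion (c v : Fin n → ℝ) (h : fderiv ℝ (expProd T) c v = 0) : v = 0 := by
  obtain ⟨ε, hε, -, himm⟩ := exists_ball_expProd_injective_immersion T hT.linearIndependent
  have hx := tendsto_dilation_atBot hT.nonneg
    (fun i hi => sub_weightZeroPart_apply c hi)
  obtain ⟨s, hs⟩ := (hx.eventually (Metric.ball_mem_nhds 0 hε)).exists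
  set A := exp (∑ i, weightZeroPart w c i • T i) with hA
  -- Up to multiplication by fixed units on both sides, `expProd T` near `c` is its own restriction
  -- to the small ball, precomposed with an invertible affine map.
  have hfun : ∀ y, D s * expProd T y
      = D s * A * Ring.inverse (D s) * expProd T (dilation w s (y - weightZeroPart w c)) * D s := by
    intro y
    rw [hT.expProd_eq c y, ← hA, mul_assoc _ _ (D s), ← hT.expProd_dilation]
    calc _ = D s * A * (Ring.inverse (D s) * D s) * expProd T (y - weightZeroPart w c) := by
          rw [Ring.inverse_mul_cancel _ (hT.isUnit s)]; noncomm_ring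
      _ = _ := by noncomm_ring
  have hcurve : HasDerivAt (fun t : ℝ => c + t • v) v 0 := by
    simpa using ((hasDerivAt_id (0 : ℝ)).smul_const v).const_add c
  have hdil : HasDerivAt (fun t : ℝ => dilation w s (c + t • v - weightZeroPart w c))
      (dilation w s v) 0 := by
    refine hasDerivAt_pi.2 fun i => ?_
    have := (((hasDerivAt_pi.1 hcurve) i).sub_const (weightZeroPart w c i)).const_mul
      (Real.exp (s * w i))
    exact this
  have hd : ∀ y, HasFDerivAt (expProd T) (fderiv ℝ (expProd T) y) y := fun y =>
    ((contDiff_expProd T).differentiable (by simp) y).hasFDerivAt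
  have h1 : HasDerivAt (fun t : ℝ => D s * expProd T (c + t • v)) (D s * 0) 0 := by
    rw [← h]
    have := hd (c + (0 : ℝ) • v)
    have h2 := this.comp_hasDerivAt (0 : ℝ) hcurve
    simp only [zero_smul, add_zero] at h2
    exact h2.const_mul (D s)
  have h2 : HasDerivAt (fun t : ℝ => D s * expProd T (c + t • v))
      (D s * A * Ring.inverse (D s) *
        fderiv ℝ (expProd T) (dilation w s (c - weightZeroPart w c)) (dilation w s v) * D s) 0 := by
    simp only [hfun]
    have := hd (dilation w s (c + (0 : ℝ) • v - weightZeroPart w c))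
    have h3 := this.comp_hasDerivAt (0 : ℝ) hdil
    simp only [zero_smul, add_zero] at h3
    exact (h3.const_mul _).mul_const _
  have h3 := h1.unique h2
  rw [mul_zero] at h3
  have hu : IsUnit (D s * A * Ring.inverse (D s)) :=
    ((hT.isUnit s).mul (isUnit_exp _)).mul (hT.isUnit s).ringInverse
  have h4 : fderiv ℝ (expProd T) (dilation w s (c - weightZeroPart w c)) (dilation w s v) = 0 := by
    have := (hT.isUnit s).mul_right_cancel ((zero_mul (D s)).trans h3)
    exact hu.mul_left_cancel (by rw [mul_zero]; exact this.symm)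
  have h5 := himm _ hs _ h4
  exact dilation_injective w s (by rw [h5]; funext i; simp [dilation])

end IsHomogeneousFamily

end Scaling

/-! ### Triangular matrices and Cholesky uniqueness. -/

section TriangularMatrices

variable {N : ℕ}

/-- Matrices whose nonzero entries sit in positions `(i, j)` with `f j < f i`. -/
def descendingMatrices {α : Type*} [Preorder α] (f : Fin N → α) : Submodule ℝ (Mat N) where
  carrier := {X | ∀ i j, ¬ f j < f i → X i j = 0}
  add_mem' := fun ha hb i j h => by simp [ha i j h, hb i j h]
  zero_mem' := fun _ _ _ => rfl
  smul_mem' := fun c X hX i j h => by simp [hX i j h]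

theorem mul_mem_descendingMatrices {α : Type*} [Preorder α] (f : Fin N → α) :
    ∀ X ∈ descendingMatrices f, ∀ Y ∈ descendingMatrices f, X * Y ∈ descendingMatrices f := by
  intro X hX Y hY i k hik
  rw [Matrix.mul_apply]
  refine Finset.sum_eq_zero fun j _ => ?_
  by_cases hij : f j < f i
  · rw [hY j k (fun h => hik (h.trans hij)), mul_zero]
  · rw [hX i j hij, zero_mul]

theorem Matrix.BlockTriangular.mul_diag {X Y : Mat N} (hX : X.BlockTriangular id)
    (hY : Y.BlockTriangular id) (i : Fin N) : (X * Y) i i = X i i * Y i i := by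
  rw [Matrix.mul_apply]
  refine Finset.sum_eq_single i (fun j _ hj => ?_) (by simp)
  rcases lt_or_gt_of_ne hj with h | h
  · rw [hX h, zero_mul]
  · rw [hY h, mul_zero]

theorem Matrix.BlockTriangular.inv_of_isUnit {X : Mat N} (hX : X.BlockTriangular id)
    (hu : IsUnit X) : X⁻¹.BlockTriangular id := by
  let _ := hu.invertible
  exact Matrix.blockTriangular_inv_of_blockTriangular hX

/-- Uniqueness in the Cholesky decomposition. -/
theorem Matrix.BlockTriangular.eq_of_mul_transpose_eq {X Y : Mat N} (hX : X.BlockTriangular id)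
    (hY : Y.BlockTriangular id) (hXu : IsUnit X) (hYu : IsUnit Y) (hXpos : ∀ i, 0 < X i i)
    (hYpos : ∀ i, 0 < Y i i) (h : X * Xᵀ = Y * Yᵀ) : X = Y := by
  have hXd := (Matrix.isUnit_iff_isUnit_det _).mp hXu
  have hYd := (Matrix.isUnit_iff_isUnit_det _).mp hYu
  -- `Q` is upper triangular and orthogonal, so `Qᵀ = Q⁻¹` is upper triangular too. Thus `Q` is
  -- diagonal with entries `±1`, and positivity of the diagonals leaves only `1`.
  set Q := Y⁻¹ * X with hQ
  have hQt : Q.BlockTriangular id := (hY.inv_of_isUnit hYu).mul hX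
  have hYQ : Y * Q = X := by rw [hQ, Matrix.mul_nonsing_inv_cancel_left _ _ hYd]
  have hQQ : Q * Qᵀ = 1 := by
    rw [hQ, Matrix.transpose_mul]
    calc Y⁻¹ * X * (Xᵀ * (Y⁻¹)ᵀ) = Y⁻¹ * (X * Xᵀ) * (Y⁻¹)ᵀ := by noncomm_ring
      _ = (Y⁻¹ * Y) * (Y⁻¹ * Y)ᵀ := by rw [h, Matrix.transpose_mul]; noncomm_ring
      _ = 1 := by rw [Matrix.nonsing_inv_mul _ hYd]; simp
  have hQu : IsUnit Q := IsUnit.of_mul_eq_one _ hQQ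
  have hQinv : Q⁻¹ = Qᵀ := Matrix.inv_eq_right_inv hQQ
  have hQtt : Qᵀ.BlockTriangular id := hQinv ▸ hQt.inv_of_isUnit hQu
  have hQdiag : ∀ i j, i ≠ j → Q i j = 0 := by
    intro i j hij
    rcases lt_or_gt_of_ne hij with h | h
    · exact hQtt (i := j) (j := i) h
    · exact hQt h
  have hQone : ∀ i, Q i i = 1 := by
    intro i
    have h1 : Q i i * Q i i = 1 := by
      have := hQt.mul_diag hQtt i
      rw [hQQ, Matrix.one_apply_eq] at this
      exact this.symm
    have h2 : Y i i * Q i i = X i i := by rw [← hY.mul_diag hQt, hYQ]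
    have h3 : 0 < Q i i := by
      have := hXpos i
      rw [← h2] at this
      exact (mul_pos_iff_of_pos_left (hYpos i)).1 this
    nlinarith
  have : Q = 1 := by
    ext i j
    by_cases hij : i = j
    · subst hij; rw [hQone, Matrix.one_apply_eq]
    · rw [hQdiag i j hij, Matrix.one_apply_ne hij]
  rw [← hYQ, this, mul_one]

theorem sq_apply_le_mul_transpose_apply (X : Mat N) (i j : Fin N) :
    X i j ^ 2 ≤ (X * Xᵀ) i i := by
  rw [Matrix.mul_apply]
  simp only [Matrix.transpose_apply, ← sq]
  exact Finset.single_le_sum (f := fun k => X i k ^ 2) (fun k _ => sq_nonneg _) (Finset.mem_univ j)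

end TriangularMatrices

/-! ### Weights of the solvable generators. -/

namespace KahlerSymmetricSpace.SolvableBasis

open NormedSpace
open scoped Matrix.Norms.Operator

variable {N : ℕ} {S : KahlerSymmetricSpace N} {d r : ℕ} (b : S.SolvableBasis d r)

theorem 𝕃_eq_expProd (Υ : Fin d → ℝ) : b.𝕃 Υ = expProd b.T Υ := by
  unfold 𝕃 rep expProd
  have h := map_list_prod ((Units.coeHom (Mat N)).comp S.U.subtype)
  refine (h _).trans ?_
  rw [List.map_ofFn]
  rfl

theorem isDiag_of_mem_span_cartan {X : Mat N}
    (hX : X ∈ Submodule.span ℝ {X | ∃ B : Fin d, (B : ℕ) < r ∧ X = b.T B}) : X.IsDiag := by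
  induction hX using Submodule.span_induction with
  | mem x hx => obtain ⟨B, hB, rfl⟩ := hx; exact b.cartan_diag B hB
  | zero => exact Matrix.isDiag_zero
  | add x y _ _ hx hy => exact hx.add hy
  | smul a x _ hx => exact hx.smul a

/-- The generators are homogeneous for the adjoint action of a diagonal matrix. -/
theorem exists_weights : ∃ (h : Fin N → ℝ) (w : Fin d → ℝ),
    (∀ A : Fin d, (A : ℕ) < r → w A = 0) ∧ (∀ A : Fin d, r ≤ (A : ℕ) → 0 < w A) ∧
    ∀ A i j, (h i - h j) * b.T A i j = w A * b.T A i j := by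
  obtain ⟨X, hX, hpos⟩ := b.positive
  have hdiag := b.isDiag_of_mem_span_cartan hX
  choose! w hw0 hw using hpos
  -- The values chosen for `w` are meaningless on the Cartan indices, where the weight is set to
  -- zero.
  refine ⟨fun i => X i i, fun A => if (A : ℕ) < r then 0 else w A, fun A hA => by simp [hA],
    fun A hA => by simp [not_lt.2 hA, hw0 A hA], fun A i j => ?_⟩
  by_cases hA : (A : ℕ) < r
  · by_cases hij : i = j
    · simp [hA, hij]
    · simp [b.cartan_diag A hA hij]
  · have h1 := congrFun (congrFun (hw A (not_lt.1 hA)) i) j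
    have h2 : X = Matrix.diagonal fun i => X i i := hdiag.diagonal_diag.symm
    rw [Ring.lie_def, Matrix.sub_apply, h2, Matrix.diagonal_mul, Matrix.mul_diagonal] at h1
    simp only [hA, if_false]
    rw [Matrix.smul_apply, smul_eq_mul] at h1
    rw [← h1]
    ring

theorem weight_eq_zero_iff {w : Fin d → ℝ} (hw0 : ∀ A : Fin d, (A : ℕ) < r → w A = 0)
    (hw : ∀ A : Fin d, r ≤ (A : ℕ) → 0 < w A) (A : Fin d) : w A = 0 ↔ (A : ℕ) < r :=
  ⟨fun h => by by_contra hA; exact (hw A (not_lt.1 hA)).ne' h, hw0 A⟩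

theorem isHomogeneousFamily {h : Fin N → ℝ} {w : Fin d → ℝ}
    (hw0 : ∀ A : Fin d, (A : ℕ) < r → w A = 0) (hw : ∀ A : Fin d, r ≤ (A : ℕ) → 0 < w A)
    (hT : ∀ A i j, (h i - h j) * b.T A i j = w A * b.T A i j) :
    IsHomogeneousFamily b.T w fun s => Matrix.diagonal fun i => Real.exp (s * h i) where
  linearIndependent := b.linearIndependent
  nonneg A := by
    rcases lt_or_ge (A : ℕ) r with hA | hA
    · exact (hw0 A hA).ge
    · exact (hw A hA).le
  isUnit s := by
    rw [Matrix.isUnit_iff_isUnit_det, Matrix.det_diagonal]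
    exact (Finset.prod_ne_zero_iff.2 fun i _ => (Real.exp_pos _).ne').isUnit
  semiconj s A := by
    ext i j
    rw [Matrix.diagonal_mul, Matrix.mul_diagonal, Matrix.smul_apply, smul_eq_mul]
    by_cases h0 : b.T A i j = 0
    · simp [h0]
    · have h1 : h i - h j = w A := mul_right_cancel₀ h0 (hT A i j)
      rw [← h1, show s * h i = s * (h i - h j) + s * h j by ring, Real.exp_add]
      ring
  commute A B hBA hA := by
    have hA' := (weight_eq_zero_iff hw0 hw A).1 hA
    have hB' : (B : ℕ) < r := lt_of_le_of_lt hBA hA'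
    rw [← (b.cartan_diag A hA').diagonal_diag, ← (b.cartan_diag B hB').diagonal_diag]
    exact Matrix.commute_diagonal _ _

end KahlerSymmetricSpace.SolvableBasis

/-! ### Triangularity, injectivity and properness of the solvable parametrization. -/

namespace KahlerSymmetricSpace.SolvableBasis

open NormedSpace
open scoped Matrix.Norms.Operator

variable {N : ℕ} {S : KahlerSymmetricSpace N} {d r : ℕ} (b : S.SolvableBasis d r)

/-- The ordered product of the exponentials is the product of a positive diagonal matrix and of
a matrix which is unipotent for the order of the rows and for the weights of `h`. -/
theorem exists_diagonal_mul_unipotent {h : Fin N → ℝ} {w : Fin d → ℝ}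
    (hw0 : ∀ A : Fin d, (A : ℕ) < r → w A = 0) (hw : ∀ A : Fin d, r ≤ (A : ℕ) → 0 < w A)
    (hT : ∀ A i j, (h i - h j) * b.T A i j = w A * b.T A i j) (c : Fin d → ℝ) :
    ∃ a : Fin N → ℝ, ∑ A, weightZeroPart w c A • b.T A = Matrix.diagonal a ∧
      expProd b.T c = Matrix.diagonal (fun i => Real.exp (a i)) *
        expProd b.T (c - weightZeroPart w c) ∧
      expProd b.T (c - weightZeroPart w c) - 1 ∈
        descendingMatrices (OrderDual.toDual : Fin N → (Fin N)ᵒᵈ) ∧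
      expProd b.T (c - weightZeroPart w c) - 1 ∈ descendingMatrices h := by
  have hdiag : (∑ A, weightZeroPart w c A • b.T A).IsDiag := by
    intro i j hij
    rw [Matrix.sum_apply]
    refine Finset.sum_eq_zero fun A _ => ?_
    by_cases hA : w A = 0
    · rw [Matrix.smul_apply, b.cartan_diag A ((weight_eq_zero_iff hw0 hw A).1 hA) hij, smul_zero]
    · simp [weightZeroPart, hA]
  obtain ⟨a, ha⟩ : ∃ a, ∑ A, weightZeroPart w c A • b.T A = Matrix.diagonal a :=
    ⟨_, hdiag.diagonal_diag.symm⟩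
  have hsupp : ∀ A, w A = 0 → (c - weightZeroPart w c) A = 0 := fun A hA =>
    sub_weightZeroPart_apply c hA
  refine ⟨a, ha, ?_, ?_, ?_⟩
  · rw [(b.isHomogeneousFamily hw0 hw hT).expProd_eq c c, ha]
    congr 1
    refine (Matrix.exp_diagonal a).trans ?_
    congr 1
    funext i
    rw [Pi.coe_exp, Real.exp_eq_exp_ℝ]
  · refine expProd_sub_one_mem _ (mul_mem_descendingMatrices _) _ _ fun A => ?_
    rcases lt_or_ge (A : ℕ) r with hA | hA
    · rw [hsupp A (hw0 A hA), zero_smul]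
      exact Submodule.zero_mem _
    · refine Submodule.smul_mem _ _ fun i j hij => b.nilpotent_upper A hA i j ?_
      simpa using hij
  · refine expProd_sub_one_mem _ (mul_mem_descendingMatrices _) _ _ fun A => ?_
    rcases lt_or_ge (A : ℕ) r with hA | hA
    · rw [hsupp A (hw0 A hA), zero_smul]
      exact Submodule.zero_mem _
    · refine Submodule.smul_mem _ _ fun i j hij => ?_
      by_contra hne
      have := mul_right_cancel₀ hne (hT A i j)
      have := hw A hA
      exact hij (by linarith)

theorem expProd_triangular {h : Fin N → ℝ} {w : Fin d → ℝ}
    (hw0 : ∀ A : Fin d, (A : ℕ) < r → w A = 0) (hw : ∀ A : Fin d, r ≤ (A : ℕ) → 0 < w A)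
    (hT : ∀ A i j, (h i - h j) * b.T A i j = w A * b.T A i j) (c : Fin d → ℝ) :
    (expProd b.T c).BlockTriangular id ∧ (∀ i, 0 < expProd b.T c i i) ∧
      ∑ A, weightZeroPart w c A • b.T A
        = Matrix.diagonal (fun i => Real.log (expProd b.T c i i)) := by
  obtain ⟨a, ha, hE, hU, -⟩ := b.exists_diagonal_mul_unipotent hw0 hw hT c
  set φ := expProd b.T (c - weightZeroPart w c)
  have hφ : ∀ i j, j ≤ i → φ i j = (1 : Mat N) i j := by
    intro i j hij
    have := hU i j (by simpa using hij)
    rwa [Matrix.sub_apply, sub_eq_zero] at this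
  have hd : ∀ i, expProd b.T c i i = Real.exp (a i) := by
    intro i
    rw [hE, Matrix.diagonal_mul, hφ i i le_rfl, Matrix.one_apply_eq, mul_one]
  refine ⟨fun i j hij => ?_, fun i => ?_, ?_⟩
  · have hij' : j < i := hij
    rw [hE, Matrix.diagonal_mul, hφ i j hij'.le, Matrix.one_apply_ne hij'.ne', mul_zero]
  · rw [hd]; exact Real.exp_pos _
  · simp only [hd, Real.log_exp]
    exact ha

theorem expProd_blockTriangular (c : Fin d → ℝ) : (expProd b.T c).BlockTriangular id := by
  obtain ⟨h, w, hw0, hw, hT⟩ := b.exists_weights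
  exact (b.expProd_triangular hw0 hw hT c).1

theorem expProd_diag_pos (c : Fin d → ℝ) (i : Fin N) : 0 < expProd b.T c i i := by
  obtain ⟨h, w, hw0, hw, hT⟩ := b.exists_weights
  exact (b.expProd_triangular hw0 hw hT c).2.1 i

/-- The logarithms of the diagonal entries determine the Cartan parameters, which is what the
homogeneous injectivity criterion needs. -/
theorem expProd_injective : Function.Injective (expProd b.T) := by
  obtain ⟨h, w, hw0, hw, hT⟩ := b.exists_weights
  intro x y hxy
  refine (b.isHomogeneousFamily hw0 hw hT).expProd_injective (fun A hA => ?_) hxy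
  have hx := (b.expProd_triangular hw0 hw hT x).2.2
  have hy := (b.expProd_triangular hw0 hw hT y).2.2
  rw [hxy, ← hy] at hx
  have := congrFun (linearIndependent_iff_injective_fintypeLinearCombination.1
    b.linearIndependent (a₁ := weightZeroPart w x) (a₂ := weightZeroPart w y) hx) A
  simpa [weightZeroPart, hA] using this

theorem expProd_mul_transpose_injective {x y : Fin d → ℝ}
    (h : expProd b.T x * (expProd b.T x)ᵀ = expProd b.T y * (expProd b.T y)ᵀ) : x = y :=
  b.expProd_injective ((b.expProd_blockTriangular x).eq_of_mul_transpose_eq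
    (b.expProd_blockTriangular y) (isUnit_expProd _ _) (isUnit_expProd _ _)
    (b.expProd_diag_pos x) (b.expProd_diag_pos y) h)

/-- Unipotent parameters are bounded in terms of the entries of the unipotent matrix. -/
theorem exists_bound_of_weightZeroPart_eq_zero {h : Fin N → ℝ} {w : Fin d → ℝ}
    (hw0 : ∀ A : Fin d, (A : ℕ) < r → w A = 0) (hw : ∀ A : Fin d, r ≤ (A : ℕ) → 0 < w A)
    (hT : ∀ A i j, (h i - h j) * b.T A i j = w A * b.T A i j) (C : ℝ) :
    ∃ R : ℝ, ∀ x : Fin d → ℝ, (∀ A, w A = 0 → x A = 0) →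
      ∑ i, ∑ j, |(expProd b.T x - 1) i j| ≤ C → ‖x‖ ≤ R := by
  have hF := b.isHomogeneousFamily hw0 hw hT
  set e : (Fin d → ℝ) → ℝ := fun x => ∑ i, ∑ j, |(expProd b.T x - 1) i j| with he
  have he0 : ∀ x, 0 ≤ e x := fun x =>
    Finset.sum_nonneg fun i _ => Finset.sum_nonneg fun j _ => abs_nonneg _
  have hent : ∀ i j, Continuous fun x => (expProd b.T x - 1) i j := fun i j =>
    (Matrix.entryLinearMap ℝ ℝ i j).toContinuousLinearMap.continuous.comp
      ((contDiff_expProd b.T).continuous.sub continuous_const)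
  have hec : Continuous e :=
    continuous_finsetSum _ fun i _ => continuous_finsetSum _ fun j _ => (hent i j).abs
  let K : Set (Fin d → ℝ) := Metric.sphere 0 1 ∩ {x | ∀ A, w A = 0 → x A = 0}
  have hK : IsCompact K := by
    refine (isCompact_sphere 0 1).inter_right ?_
    simp only [Set.ofPred_forall]
    exact isClosed_iInter fun A => isClosed_iInter fun _ =>
      isClosed_eq (continuous_apply A) continuous_const
  -- By compactness, `e` is bounded below on the unit sphere of nilpotent parameters: it could
  -- vanish there only at the origin, by injectivity.
  obtain ⟨m, hm, hmK⟩ : ∃ m : ℝ, 0 < m ∧ ∀ x ∈ K, m ≤ e x := by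
    rcases K.eq_empty_or_nonempty with h0 | h0
    · exact ⟨1, one_pos, by simp [h0]⟩
    · obtain ⟨x, hx, hmin⟩ := hK.exists_isMinOn h0 hec.continuousOn
      refine ⟨e x, (he0 x).lt_of_ne fun h1 => ?_, fun y hy => hmin hy⟩
      have h2 : expProd b.T x = expProd b.T 0 := by
        rw [expProd_zero, ← sub_eq_zero]
        ext i j
        have h3 := (Finset.sum_eq_zero_iff_of_nonneg (fun i _ =>
          Finset.sum_nonneg fun j _ => abs_nonneg _)).1 h1.symm i (Finset.mem_univ i)
        have h4 := (Finset.sum_eq_zero_iff_of_nonneg (fun j _ => abs_nonneg _)).1 h3 j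
          (Finset.mem_univ j)
        exact abs_eq_zero.1 h4
      have h5 : x = 0 := b.expProd_injective h2
      have h6 : ‖x‖ = 1 := by simpa using hx.1
      simp [h5] at h6
  -- `μ` is a lower bound for the finitely many positive gaps `h i - h j`; it is the minimal
  -- contraction rate of the entries of `expProd b.T x - 1`.
  obtain ⟨μ, hμ, hμh⟩ : ∃ μ : ℝ, 0 < μ ∧ ∀ i j, h j < h i → μ ≤ h i - h j := by
    have : ∀ᶠ μ : ℝ in nhdsWithin 0 (Set.Ioi 0), ∀ p : Fin N × Fin N,
        h p.2 < h p.1 → μ ≤ h p.1 - h p.2 := by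
      refine Filter.eventually_all.2 fun p => ?_
      by_cases hp : h p.2 < h p.1
      · filter_upwards [mem_nhdsWithin_of_mem_nhds (Iic_mem_nhds (sub_pos.2 hp))] with μ hμ _
        exact hμ
      · exact Filter.Eventually.of_forall fun μ hp' => absurd hp' hp
    obtain ⟨μ, hμ, hμ0⟩ := (this.and self_mem_nhdsWithin).exists
    exact ⟨μ, hμ0, fun i j => hμ (i, j)⟩
  have hscale : ∀ s ≤ 0, ∀ x : Fin d → ℝ, (∀ A, w A = 0 → x A = 0) →
      e (dilation w s x) ≤ Real.exp (s * μ) * e x := by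
    intro s hs x hx
    simp only [he, Finset.mul_sum]
    refine Finset.sum_le_sum fun i _ => Finset.sum_le_sum fun j _ => ?_
    have hx0 : x - weightZeroPart w x = x := by
      funext A
      by_cases hA : w A = 0 <;> simp [weightZeroPart, hA, hx]
    obtain ⟨-, -, -, -, hdesc⟩ := b.exists_diagonal_mul_unipotent hw0 hw hT x
    rw [hx0] at hdesc
    have h1 : Real.exp (s * h i) * (expProd b.T x - 1) i j
        = (expProd b.T (dilation w s x) - 1) i j * Real.exp (s * h j) := by
      have h2 := congrFun (congrFun (hF.expProd_dilation s x) i) j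
      rw [Matrix.diagonal_mul, Matrix.mul_diagonal] at h2
      rw [Matrix.sub_apply, Matrix.sub_apply, mul_sub, sub_mul, h2]
      by_cases hij : i = j
      · subst hij; rw [mul_comm (Real.exp _) ((1 : Mat N) i i)]
      · rw [Matrix.one_apply_ne hij]; simp
    have h3 : (expProd b.T (dilation w s x) - 1) i j
        = Real.exp (s * (h i - h j)) * (expProd b.T x - 1) i j := by
      rw [mul_sub s, Real.exp_sub, div_mul_eq_mul_div, h1, mul_div_assoc,
        div_self (Real.exp_pos _).ne', mul_one]
    rw [h3, abs_mul, abs_of_pos (Real.exp_pos _)]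
    by_cases hij : h j < h i
    · refine mul_le_mul_of_nonneg_right (Real.exp_le_exp.2 ?_) (abs_nonneg _)
      nlinarith [hμh i j hij]
    · rw [hdesc i j hij]; simp
  obtain ⟨s, hs0, hsC⟩ : ∃ s : ℝ, s ≤ 0 ∧ Real.exp (s * μ) * C < m := by
    have h1 : Filter.Tendsto (fun s : ℝ => Real.exp (s * μ) * C) Filter.atBot (nhds (0 * C)) :=
      (Real.tendsto_exp_atBot.comp (Filter.tendsto_id.atBot_mul_const hμ)).mul_const C
    rw [zero_mul] at h1
    obtain ⟨s, h2, h3⟩ := ((Filter.eventually_le_atBot (0 : ℝ)).and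
      (h1.eventually (gt_mem_nhds hm))).exists
    exact ⟨s, h2, h3⟩
  refine ⟨∑ A, Real.exp (-(s * w A)), fun x hx hxC => ?_⟩
  have hCn : 0 ≤ C := (he0 x).trans hxC
  -- Otherwise, contracting further, the dilated point crosses the unit sphere at some `u ≤ s`.
  -- There `e` is at least `m`, but also at most `exp (s * μ) * C < m`.
  have hlt : ‖dilation w s x‖ < 1 := by
    by_contra hge
    have hlim := (tendsto_dilation_atBot hF.nonneg hx).norm
    rw [norm_zero] at hlim
    obtain ⟨s', hs', hs'1⟩ := ((hlim.eventually (gt_mem_nhds one_pos)).and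
      (Filter.eventually_le_atBot s)).exists
    obtain ⟨u, hu, hu1⟩ := intermediate_value_Icc hs'1 (continuous_dilation w x).norm.continuousOn
      ⟨hs'.le, not_lt.1 hge⟩
    have hmem : dilation w u x ∈ K := ⟨by simpa using hu1, fun A hA => by simp [dilation, hx A hA]⟩
    have h1 := hmK _ hmem
    have h2 := hscale u (hu.2.trans hs0) x hx
    have h3 : Real.exp (u * μ) * e x ≤ Real.exp (s * μ) * C :=
      mul_le_mul (Real.exp_le_exp.2 (by nlinarith [hu.2])) hxC (he0 x) (Real.exp_pos _).le
    linarith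
  refine (pi_norm_le_iff_of_nonneg (Finset.sum_nonneg fun A _ => (Real.exp_pos _).le)).2 fun A => ?_
  have h1 : ‖dilation w s x A‖ ≤ 1 := (norm_le_pi_norm _ A).trans hlt.le
  rw [dilation, Real.norm_eq_abs, abs_mul, abs_of_pos (Real.exp_pos _)] at h1
  have h2 : |x A| ≤ Real.exp (-(s * w A)) := by
    rw [Real.exp_neg, ← one_div, le_div_iff₀ (Real.exp_pos _), mul_comm]
    exact h1
  exact h2.trans (Finset.single_le_sum (f := fun A => Real.exp (-(s * w A)))
    (fun A _ => (Real.exp_pos _).le) (Finset.mem_univ A))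

/-- The solvable parametrization is proper. -/
theorem exists_bound (C : ℝ) : ∃ R : ℝ, ∀ c : Fin d → ℝ, (∀ i j, |expProd b.T c i j| ≤ C) →
    (∀ i j, |(expProd b.T c)⁻¹ i j| ≤ C) → ‖c‖ ≤ R := by
  obtain ⟨h, w, hw0, hw, hT⟩ := b.exists_weights
  obtain ⟨q, hq⟩ := (Fintype.linearCombination ℝ b.T).exists_leftInverse_of_injective
    (LinearMap.ker_eq_bot.2 (linearIndependent_iff_injective_fintypeLinearCombination.1
      b.linearIndependent))
  have hq' : ∀ v : Fin d → ℝ, q (∑ i, v i • b.T i) = v := fun v => LinearMap.congr_fun hq v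
  let Q : (Fin N → ℝ) →L[ℝ] (Fin d → ℝ) :=
    (q.comp (Matrix.diagonalLinearMap (Fin N) ℝ ℝ)).toContinuousLinearMap
  -- An entry of the unipotent factor is `exp (-(a i))` times one of `E`, hence at most `C * C` in
  -- absolute value; subtracting the identity costs at most `1`.
  obtain ⟨R, hR⟩ := b.exists_bound_of_weightZeroPart_eq_zero hw0 hw hT
    (∑ _i : Fin N, ∑ _j : Fin N, (C * C + 1))
  refine ⟨‖Q‖ * |C| + R, fun c hE hE' => ?_⟩
  obtain ⟨a, ha, hdec, -, -⟩ := b.exists_diagonal_mul_unipotent hw0 hw hT c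
  obtain ⟨htri, hpos, hlog⟩ := b.expProd_triangular hw0 hw hT c
  have hdiag : ∀ i, expProd b.T c i i = Real.exp (a i) := by
    intro i
    have := congrFun (congrFun (ha.symm.trans hlog) i) i
    rw [Matrix.diagonal_apply_eq, Matrix.diagonal_apply_eq] at this
    rw [this, Real.exp_log (hpos i)]
  have hdiag' : ∀ i, (expProd b.T c)⁻¹ i i = Real.exp (-(a i)) := by
    intro i
    have h1 := htri.mul_diag (htri.inv_of_isUnit (isUnit_expProd b.T c)) i
    rw [Matrix.mul_nonsing_inv _ ((Matrix.isUnit_iff_isUnit_det _).mp (isUnit_expProd b.T c)),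
      Matrix.one_apply_eq, hdiag] at h1
    rw [Real.exp_neg]
    exact eq_inv_of_mul_eq_one_right h1.symm
  have hexp : ∀ i, Real.exp (a i) ≤ C ∧ Real.exp (-(a i)) ≤ C := fun i =>
    ⟨by rw [← hdiag]; exact (le_abs_self _).trans (hE i i),
      by rw [← hdiag']; exact (le_abs_self _).trans (hE' i i)⟩
  -- The bounds `±a i ≤ C` come from `x + 1 ≤ exp x`, applied to the diagonals of `E` and of `E⁻¹`.
  have hanorm : ‖a‖ ≤ |C| := by
    refine (pi_norm_le_iff_of_nonneg (abs_nonneg C)).2 fun i => ?_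
    rw [Real.norm_eq_abs]
    refine le_trans (abs_le.2 ⟨?_, ?_⟩) (le_abs_self C)
    · have := Real.add_one_le_exp (-(a i))
      have := (hexp i).2
      linarith
    · have := Real.add_one_le_exp (a i)
      have := (hexp i).1
      linarith
  have h1 : ‖weightZeroPart w c‖ ≤ ‖Q‖ * |C| := by
    have : Q a = weightZeroPart w c := by
      rw [← hq' (weightZeroPart w c), ha]
      rfl
    rw [← this]
    exact (Q.le_opNorm a).trans (mul_le_mul_of_nonneg_left hanorm (norm_nonneg Q))
  have h2 : ‖c - weightZeroPart w c‖ ≤ R := by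
    refine hR _ (fun A hA => sub_weightZeroPart_apply c hA) ?_
    refine Finset.sum_le_sum fun i _ => Finset.sum_le_sum fun j _ => ?_
    have h3 : expProd b.T (c - weightZeroPart w c) i j
        = Real.exp (-(a i)) * expProd b.T c i j := by
      rw [hdec, Matrix.diagonal_mul, ← mul_assoc, ← Real.exp_add]
      simp
    rw [Matrix.sub_apply]
    refine (abs_sub _ _).trans (add_le_add ?_ ?_)
    · rw [h3, abs_mul, abs_of_pos (Real.exp_pos _)]
      exact mul_le_mul (hexp i).2 (hE i j) (abs_nonneg _)
        ((Real.exp_pos _).le.trans (hexp i).2)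
    · by_cases hij : i = j
      · subst hij; simp
      · simp [Matrix.one_apply_ne hij]
  calc ‖c‖ = ‖weightZeroPart w c + (c - weightZeroPart w c)‖ := by rw [add_sub_cancel]
    _ ≤ _ := (norm_add_le _ _).trans (add_le_add h1 h2)

end KahlerSymmetricSpace.SolvableBasis

/-! ### The quotient `U/H`, global coordinates and the local action. -/

namespace KahlerSymmetricSpace

variable {N : ℕ} (S : KahlerSymmetricSpace N)

/-- The inclusion of `U` into the matrices. -/
def toMat : S.U →* Mat N := (Units.coeHom (Mat N)).comp S.U.subtype

theorem toMat_mul_toMat_inv (g : S.U) : S.toMat g * S.toMat g⁻¹ = 1 := by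
  rw [← map_mul, mul_inv_cancel, map_one]

theorem toMat_inv_mul_toMat (g : S.U) : S.toMat g⁻¹ * S.toMat g = 1 := by
  rw [← map_mul, inv_mul_cancel, map_one]

theorem mem_H_iff (g : S.U) : g ∈ S.H ↔ S.toMat g * (S.toMat g)ᵀ = 1 := by
  unfold H
  rw [Subgroup.mem_subgroupOf, Submonoid.mem_units_iff]
  have h : ∀ x : S.U, (((x : GL (Fin N) ℝ) : Mat N) ∈ Matrix.orthogonalGroup (Fin N) ℝ ↔
      S.toMat x * (S.toMat x)ᵀ = 1) := fun x => Matrix.mem_orthogonalGroup_iff _ _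
  refine ⟨fun hg => (h g).1 hg.1, fun hg => ⟨(h g).2 hg, (h g⁻¹).2 ?_⟩⟩
  have h1 : S.toMat g⁻¹ = (S.toMat g)ᵀ := by
    calc S.toMat g⁻¹ = S.toMat g⁻¹ * (S.toMat g * (S.toMat g)ᵀ) := by rw [hg, mul_one]
      _ = (S.toMat g)ᵀ := by rw [← mul_assoc, toMat_inv_mul_toMat, one_mul]
  rw [h1, Matrix.transpose_transpose, ← h1, toMat_inv_mul_toMat]

theorem coset_eq_iff (g g' : S.U) : (g : S.U ⧸ S.H) = g' ↔
    S.toMat g * (S.toMat g)ᵀ = S.toMat g' * (S.toMat g')ᵀ := by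
  rw [QuotientGroup.eq, mem_H_iff, map_mul, Matrix.transpose_mul]
  have hT : (S.toMat g⁻¹)ᵀ * (S.toMat g)ᵀ = 1 := by
    rw [← Matrix.transpose_mul, toMat_mul_toMat_inv, Matrix.transpose_one]
  have hT' : (S.toMat g)ᵀ * (S.toMat g⁻¹)ᵀ = 1 := by
    rw [← Matrix.transpose_mul, toMat_inv_mul_toMat, Matrix.transpose_one]
  constructor
  · intro h
    calc S.toMat g * (S.toMat g)ᵀ
        = S.toMat g * (S.toMat g⁻¹ * S.toMat g' * ((S.toMat g')ᵀ * (S.toMat g⁻¹)ᵀ))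
            * (S.toMat g)ᵀ := by rw [h, mul_one]
      _ = (S.toMat g * S.toMat g⁻¹) * (S.toMat g' * (S.toMat g')ᵀ)
            * ((S.toMat g⁻¹)ᵀ * (S.toMat g)ᵀ) := by noncomm_ring
      _ = _ := by rw [toMat_mul_toMat_inv, hT, one_mul, mul_one]
  · intro h
    calc S.toMat g⁻¹ * S.toMat g' * ((S.toMat g')ᵀ * (S.toMat g⁻¹)ᵀ)
        = S.toMat g⁻¹ * (S.toMat g' * (S.toMat g')ᵀ) * (S.toMat g⁻¹)ᵀ := by noncomm_ring
      _ = (S.toMat g⁻¹ * S.toMat g) * ((S.toMat g)ᵀ * (S.toMat g⁻¹)ᵀ) := by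
          rw [← h]; noncomm_ring
      _ = 1 := by rw [toMat_inv_mul_toMat, hT', one_mul]

namespace SolvableBasis

open NormedSpace
open scoped Matrix.Norms.Operator

variable {S} {d r : ℕ} (b : S.SolvableBasis d r)

theorem toMat_rep (Υ : Fin d → ℝ) : S.toMat (b.rep Υ) = expProd b.T Υ := b.𝕃_eq_expProd Υ

theorem point_injective : Function.Injective b.point := by
  intro x y h
  have h' := (S.coset_eq_iff _ _).1 h
  rw [toMat_rep, toMat_rep] at h'
  exact b.expProd_mul_transpose_injective h'

/-- Injectivity of `point` is enough to evaluate `Function.invFun` at a point known to be in the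
chart, so the action can be computed before surjectivity is available. -/
theorem act_eq {g : S.U} {x y : Fin d → ℝ} (h : expProd b.T y * (expProd b.T y)ᵀ
      = S.toMat g * (expProd b.T x * (expProd b.T x)ᵀ) * (S.toMat g)ᵀ) : b.act g x = y := by
  have h1 : g • b.point x = b.point y := by
    change ((g * b.rep x : S.U) : S.U ⧸ S.H) = (b.rep y : S.U ⧸ S.H)
    rw [coset_eq_iff, map_mul, toMat_rep, toMat_rep, h, Matrix.transpose_mul]
    noncomm_ring
  unfold act
  rw [h1]
  exact Function.leftInverse_invFun b.point_injective y

theorem immersion (c v : Fin d → ℝ) (h : fderiv ℝ (expProd b.T) c v = 0) : v = 0 := by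
  obtain ⟨_, w, hw0, hw, hT⟩ := b.exists_weights
  exact (b.isHomogeneousFamily hw0 hw hT).expProd_immersion c v h

theorem stable_𝔲 (A : Fin d) : ∀ Y ∈ S.𝔲.toSubmodule, b.T A * Y - Y * b.T A ∈ S.𝔲.toSubmodule :=
  fun _ hY => S.𝔲.lie_mem (b.mem A) hY

/-- The projection onto the solvable algebra along `ℍ`, in components. -/
theorem exists_projection : ∃ q : Mat N →ₗ[ℝ] (Fin d → ℝ),
    (∀ v : Fin d → ℝ, q (∑ A, v A • b.T A) = v) ∧ ∀ X ∈ S.𝔲.toSubmodule, q X = 0 → X ∈ S.ℍ := by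
  have hinj : LinearMap.ker (S.ℍ.mkQ.comp (Fintype.linearCombination ℝ b.T)) = ⊥ := by
    refine LinearMap.ker_eq_bot'.2 fun v hv => ?_
    rw [LinearMap.comp_apply, Submodule.mkQ_apply, Submodule.Quotient.mk_eq_zero] at hv
    have hs : Fintype.linearCombination ℝ b.T v ∈ Submodule.span ℝ (Set.range b.T) := by
      rw [← Fintype.range_linearCombination]
      exact ⟨v, rfl⟩
    have h0 := Submodule.disjoint_def.1 b.disjoint _ hv hs
    exact linearIndependent_iff_injective_fintypeLinearCombination.1 b.linearIndependent
      (h0.trans (map_zero _).symm)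
  -- `Solv` meets `ℍ` trivially, so it embeds in the quotient by `ℍ`. A left inverse of this
  -- embedding, precomposed with the quotient map, vanishes on `ℍ`.
  obtain ⟨p, hp⟩ := LinearMap.exists_leftInverse_of_injective _ hinj
  have hq : ∀ v : Fin d → ℝ, (p.comp S.ℍ.mkQ) (∑ A, v A • b.T A) = v :=
    fun v => LinearMap.congr_fun hp v
  refine ⟨p.comp S.ℍ.mkQ, hq, fun X hX hX0 => ?_⟩
  rw [← b.sup_eq] at hX
  obtain ⟨η, hη, Y, hY, rfl⟩ := Submodule.mem_sup.1 hX
  obtain ⟨v, rfl⟩ := (Submodule.mem_span_range_iff_exists_fun ℝ).1 hY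
  have hη0 : (p.comp S.ℍ.mkQ) η = 0 := by
    rw [LinearMap.comp_apply, Submodule.mkQ_apply, (Submodule.Quotient.mk_eq_zero _).2 hη, map_zero]
  rw [map_add, hη0, zero_add, hq] at hX0
  simpa [hX0] using hη

theorem inverse_expProd (c : Fin d → ℝ) : Ring.inverse (expProd b.T c) = (expProd b.T c)⁻¹ :=
  (Matrix.nonsing_inv_eq_ringInverse (expProd b.T c)).symm

/-- The action of a one-parameter group of isometries in solvable coordinates, near the identity. -/
theorem exists_local_action {J : Mat N} (hJ : J ∈ S.𝔲) (c : Fin d → ℝ) :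
    ∃ (α : ℝ → Fin d → ℝ) (v : Fin d → ℝ) (ε : ℝ), 0 < ε ∧ HasDerivAt α v 0 ∧
      (expProd b.T c)⁻¹ * fderiv ℝ (expProd b.T) c v - (expProd b.T c)⁻¹ * J * expProd b.T c
        ∈ S.ℍ ∧
      ∀ t ∈ Set.Ioo (-ε) ε, expProd b.T (α t) * (expProd b.T (α t))ᵀ
        = exp (t • J) * (expProd b.T c * (expProd b.T c)ᵀ) * (exp (t • J))ᵀ := by
  obtain ⟨q, hq, hq0⟩ := b.exists_projection
  obtain ⟨α, v, ε, hε, -, hv, hqv, hα⟩ := exists_local_flow b.T (fun A B => b.lie_mem A B)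
    b.immersion q hq (Matrix.transposeLinearEquiv (Fin N) (Fin N) ℝ ℝ).toLinearMap
    (fun x y => Matrix.transpose_mul x y) S.𝔲.toSubmodule b.mem b.stable_𝔲
    (fun x hx h => (hq0 x hx h).2) hJ c
  refine ⟨α, v, ε, hε, hv, ?_, fun t ht => ?_⟩
  · rw [← inverse_expProd]
    refine hq0 _ (sub_mem (fderiv_expProd_mem b.T _ b.mem b.stable_𝔲 c v)
      (expProd_conj_mem b.T _ b.stable_𝔲 c hJ)) ?_
    exact (map_sub q _ _).trans (sub_eq_zero.2 hqv)
  · have h : exp (t • -J) * expProd b.T (α t) * (exp (t • -J) * expProd b.T (α t))ᵀ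
        = expProd b.T c * (expProd b.T c)ᵀ := hα t ht
    have h1 : exp (t • J) * exp (t • -J) = 1 := by
      rw [smul_neg]; exact exp_mul_exp_neg (t • J)
    rw [← h, Matrix.transpose_mul]
    calc _ = (exp (t • J) * exp (t • -J)) * (expProd b.T (α t) * (expProd b.T (α t))ᵀ)
          * (exp (t • J) * exp (t • -J))ᵀ := by rw [h1]; simp
      _ = _ := by rw [Matrix.transpose_mul (exp (t • J))]; noncomm_ring

/-- Along a convergent sequence of times, the diagonals of `E Eᵀ` and of its inverse stay bounded,
and they bound the entries of `E` and `E⁻¹`. Properness then confines the parameters to a compact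
ball, and a limit point gives the parameters at the limit time. -/
theorem isClosed_orbit_times {J : Mat N} (c₀ : Fin d → ℝ) :
    IsClosed {t : ℝ | ∃ c, expProd b.T c * (expProd b.T c)ᵀ
      = exp (t • J) * (expProd b.T c₀ * (expProd b.T c₀)ᵀ) * (exp (t • J))ᵀ} := by
  have hE : Continuous (expProd b.T) := (contDiff_expProd b.T).continuous
  have hT : Continuous fun X : Mat N => Xᵀ := by fun_prop
  have hexp : ∀ X : Mat N, Continuous fun t : ℝ => exp (t • X) := fun X =>
    continuous_iff_continuousAt.2 fun t => (hasDerivAt_exp_smul_const X t).continuousAt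
  set Γ : ℝ → Mat N := fun t =>
    exp (t • J) * (expProd b.T c₀ * (expProd b.T c₀)ᵀ) * (exp (t • J))ᵀ with hΓ
  set Γ' : ℝ → Mat N := fun t => (exp (t • -J))ᵀ *
    (((expProd b.T c₀)⁻¹)ᵀ * (expProd b.T c₀)⁻¹) * exp (t • -J) with hΓ'
  have hΓc : Continuous Γ := ((hexp J).mul continuous_const).mul (hT.comp (hexp J))
  have hΓ'c : Continuous Γ' := ((hT.comp (hexp (-J))).mul continuous_const).mul (hexp (-J))
  have hentry : ∀ i j, Continuous fun X : Mat N => X i j := fun i j =>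
    (Matrix.entryLinearMap ℝ ℝ i j).toContinuousLinearMap.continuous
  have hinv : ∀ c, (expProd b.T c)⁻¹ * expProd b.T c = 1 := fun c =>
    Matrix.nonsing_inv_mul _ ((Matrix.isUnit_iff_isUnit_det _).mp (isUnit_expProd b.T c))
  have hinv' : ∀ c, expProd b.T c * (expProd b.T c)⁻¹ = 1 := fun c =>
    Matrix.mul_nonsing_inv _ ((Matrix.isUnit_iff_isUnit_det _).mp (isUnit_expProd b.T c))
  have hinvT : ∀ c, (expProd b.T c)ᵀ * ((expProd b.T c)⁻¹)ᵀ = 1 := fun c => by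
    rw [← Matrix.transpose_mul, hinv, Matrix.transpose_one]
  have hΓΓ' : ∀ t c, expProd b.T c * (expProd b.T c)ᵀ = Γ t →
      ((expProd b.T c)⁻¹)ᵀ * (expProd b.T c)⁻¹ = Γ' t := by
    intro t c h
    have h1 : exp (t • J) * exp (t • -J) = 1 := by
      rw [smul_neg]; exact exp_mul_exp_neg (t • J)
    have h1T : (exp (t • J))ᵀ * (exp (t • -J))ᵀ = 1 := by
      have h2 : exp (t • -J) * exp (t • J) = 1 := by
        rw [smul_neg]; exact exp_neg_mul_exp (t • J)
      rw [← Matrix.transpose_mul, h2, Matrix.transpose_one]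
    have h2 : Γ t * Γ' t = 1 := by
      calc Γ t * Γ' t = exp (t • J) * (expProd b.T c₀ * ((expProd b.T c₀)ᵀ *
            ((exp (t • J))ᵀ * (exp (t • -J))ᵀ) * ((expProd b.T c₀)⁻¹)ᵀ) * (expProd b.T c₀)⁻¹)
            * exp (t • -J) := by rw [hΓ, hΓ']; noncomm_ring
        _ = 1 := by rw [h1T, mul_one, hinvT, mul_one, hinv', mul_one, h1]
    have h3 : ((expProd b.T c)⁻¹)ᵀ * (expProd b.T c)⁻¹ * Γ t = 1 := by
      rw [← h]
      calc _ = ((expProd b.T c)⁻¹)ᵀ * ((expProd b.T c)⁻¹ * expProd b.T c) * (expProd b.T c)ᵀ := by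
            noncomm_ring
        _ = (expProd b.T c * (expProd b.T c)⁻¹)ᵀ := by
            rw [hinv, mul_one, Matrix.transpose_mul]
        _ = 1 := by rw [hinv', Matrix.transpose_one]
    exact left_inv_eq_right_inv h3 h2
  refine IsSeqClosed.isClosed fun t t₀ ht htt => ?_
  choose c hc using ht
  have hbd : ∀ F : ℝ → Mat N, Continuous F → ∃ C : ℝ, ∀ k i x, x ^ 2 ≤ F (t k) i i → |x| ≤ C := by
    intro F hF
    have h1 : ∀ i, ∃ C : ℝ, ∀ k, F (t k) i i ≤ C := fun i => by
      obtain ⟨C, hC⟩ := ((((hentry i i).comp hF).tendsto t₀).comp htt).bddAbove_range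
      exact ⟨C, fun k => hC ⟨k, rfl⟩⟩
    choose C hC using h1
    -- For `a ≥ 0`, `x ^ 2 ≤ a` implies `|x| ≤ a + 1`, which avoids a square root.
    refine ⟨∑ i, |C i| + 1, fun k i x hx => ?_⟩
    have h2 := (hC i k).trans ((le_abs_self _).trans
      (Finset.single_le_sum (f := fun i => |C i|) (fun i _ => abs_nonneg _) (Finset.mem_univ i)))
    have h3 : 0 ≤ ∑ i, |C i| := Finset.sum_nonneg fun i _ => abs_nonneg _
    exact abs_le_of_sq_le_sq (by nlinarith) (by positivity)
  obtain ⟨C, hC⟩ := hbd Γ hΓc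
  obtain ⟨C', hC'⟩ := hbd Γ' hΓ'c
  obtain ⟨R, hR⟩ := b.exists_bound (max C C')
  have hcR : ∀ k, c k ∈ Metric.closedBall (0 : Fin d → ℝ) R := by
    intro k
    rw [mem_closedBall_zero_iff]
    refine hR _ (fun i j => (hC k i _ ?_).trans (le_max_left _ _))
      (fun i j => (hC' k j _ ?_).trans (le_max_right _ _))
    · have := sq_apply_le_mul_transpose_apply (expProd b.T (c k)) i j
      rwa [hc k] at this
    · have := sq_apply_le_mul_transpose_apply ((expProd b.T (c k))⁻¹)ᵀ j i
      rwa [Matrix.transpose_transpose, hΓΓ' (t k) (c k) (hc k)] at this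
  obtain ⟨a, -, φ, hφ, ha⟩ := (isCompact_closedBall (0 : Fin d → ℝ) R).tendsto_subseq hcR
  refine ⟨a, ?_⟩
  have h1 := ((hE.mul (hT.comp hE)).tendsto a).comp ha
  have h2 := (hΓc.tendsto t₀).comp (htt.comp hφ.tendsto_atTop)
  refine tendsto_nhds_unique h1 (h2.congr fun k => ?_)
  exact (hc (φ k)).symm

theorem exists_expProd_mul_transpose_eq_exp {J : Mat N} (hJ : J ∈ S.𝔲) (c₀ : Fin d → ℝ) (t : ℝ) :
    ∃ c, expProd b.T c * (expProd b.T c)ᵀ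
      = exp (t • J) * (expProd b.T c₀ * (expProd b.T c₀)ᵀ) * (exp (t • J))ᵀ := by
  have hadd : ∀ s t : ℝ, exp ((s + t) • J) = exp (s • J) * exp (t • J) := fun s t => by
    rw [add_smul]
    exact exp_add_of_commute (((Commute.refl J).smul_left s).smul_right t)
  -- If time `t` is reached at parameters `c`, the local flow started at `c` covers all nearby
  -- times. Connectedness of `ℝ` then finishes.
  have hopen : IsOpen {t : ℝ | ∃ c, expProd b.T c * (expProd b.T c)ᵀ
      = exp (t • J) * (expProd b.T c₀ * (expProd b.T c₀)ᵀ) * (exp (t • J))ᵀ} := by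
    refine Metric.isOpen_iff.2 fun t ⟨c, hc⟩ => ?_
    obtain ⟨α, -, ε, hε, -, -, hα⟩ := b.exists_local_action hJ c
    refine ⟨ε, hε, fun s hs => ⟨α (s - t), ?_⟩⟩
    rw [Metric.mem_ball, Real.dist_eq, abs_lt] at hs
    rw [hα (s - t) hs, hc]
    have := hadd (s - t) t
    rw [sub_add_cancel] at this
    rw [this, Matrix.transpose_mul]
    noncomm_ring
  have huniv := IsClopen.eq_univ ⟨b.isClosed_orbit_times (J := J) c₀, hopen⟩ ⟨0, c₀, by simp⟩
  have : t ∈ (Set.univ : Set ℝ) := Set.mem_univ t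
  rwa [← huniv] at this

theorem exists_expProd_mul_transpose_eq (g : S.U) (c₀ : Fin d → ℝ) :
    ∃ c, expProd b.T c * (expProd b.T c)ᵀ
      = S.toMat g * (expProd b.T c₀ * (expProd b.T c₀)ᵀ) * (S.toMat g)ᵀ := by
  -- The claim for `g⁻¹` is carried along so that the induction over the generated subgroup passes
  -- through inverses.
  have key : ∀ g ∈ S.U, ∀ c₀, (∃ c, expProd b.T c * (expProd b.T c)ᵀ
      = (g : Mat N) * (expProd b.T c₀ * (expProd b.T c₀)ᵀ) * (g : Mat N)ᵀ) ∧
      ∃ c, expProd b.T c * (expProd b.T c)ᵀ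
      = ((g⁻¹ : GL (Fin N) ℝ) : Mat N) * (expProd b.T c₀ * (expProd b.T c₀)ᵀ)
        * ((g⁻¹ : GL (Fin N) ℝ) : Mat N)ᵀ := by
    intro g hg
    induction hg using Subgroup.closure_induction with
    | mem x hx =>
      obtain ⟨J, hJ, rfl⟩ := hx
      intro c₀
      have h1 : ((expGL J : GL (Fin N) ℝ) : Mat N) = exp J := rfl
      have h2 : (((expGL J)⁻¹ : GL (Fin N) ℝ) : Mat N) = exp (-J) := by
        rw [Matrix.coe_units_inv, h1, Matrix.exp_neg]
      rw [h1, h2]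
      constructor
      · simpa using b.exists_expProd_mul_transpose_eq_exp hJ c₀ 1
      · simpa using b.exists_expProd_mul_transpose_eq_exp hJ c₀ (-1)
    | one => exact fun c₀ => ⟨⟨c₀, by simp⟩, ⟨c₀, by simp⟩⟩
    | mul x y _ _ hx hy =>
      intro c₀
      obtain ⟨c₁, h₁⟩ := (hy c₀).1
      obtain ⟨c₂, h₂⟩ := (hx c₁).1
      obtain ⟨c₃, h₃⟩ := (hx c₀).2
      obtain ⟨c₄, h₄⟩ := (hy c₃).2
      refine ⟨⟨c₂, ?_⟩, ⟨c₄, ?_⟩⟩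
      · rw [h₂, h₁, Units.val_mul, Matrix.transpose_mul]
        noncomm_ring
      · rw [h₄, h₃, mul_inv_rev, Units.val_mul, Matrix.transpose_mul]
        noncomm_ring
    | inv x _ hx =>
      intro c₀
      rw [inv_inv]
      exact ⟨(hx c₀).2, (hx c₀).1⟩
  exact (key g g.2 c₀).1

theorem point_bijective : Function.Bijective b.point := by
  refine ⟨b.point_injective, fun x => ?_⟩
  obtain ⟨g, rfl⟩ := QuotientGroup.mk_surjective x
  -- At parameter `0` the representative is `1`, so the orbit of this base point is the set of all
  -- `g gᵀ`.
  obtain ⟨c, hc⟩ := b.exists_expProd_mul_transpose_eq g 0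
  refine ⟨c, (S.coset_eq_iff _ _).2 ?_⟩
  rw [toMat_rep, hc, expProd_zero]
  simp

/-! ### The Maurer–Cartan form, the Killing field and the differential of `𝔓`. -/

theorem Θ_eq (Υ v : Fin d → ℝ) :
    b.Θ Υ v = (expProd b.T Υ)⁻¹ * fderiv ℝ (expProd b.T) Υ v := by
  unfold Θ
  rw [b.𝕃_eq_expProd]
  congr 1
  ext i j
  rw [Matrix.of_apply]
  simp only [b.𝕃_eq_expProd]
  have h := ((Matrix.entryLinearMap ℝ ℝ i j).toContinuousLinearMap.hasFDerivAt.comp Υ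
    ((contDiff_expProd b.T).differentiable (by simp) Υ).hasFDerivAt).fderiv
  exact congrArg (fun L : (Fin d → ℝ) →L[ℝ] ℝ => L v) h

theorem Θ_mem (Υ v : Fin d → ℝ) : b.Θ Υ v ∈ S.𝔲 := by
  rw [Θ_eq, ← inverse_expProd]
  exact fderiv_expProd_mem b.T S.𝔲.toSubmodule b.mem b.stable_𝔲 Υ v

theorem conj_mem {J : Mat N} (hJ : J ∈ S.𝔲) (Υ : Fin d → ℝ) :
    (b.𝕃 Υ)⁻¹ * J * b.𝕃 Υ ∈ S.𝔲 := by
  rw [b.𝕃_eq_expProd, ← inverse_expProd]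
  exact expProd_conj_mem b.T S.𝔲.toSubmodule b.stable_𝔲 Υ hJ

/-- The Killing vector field exists, and its Maurer–Cartan form agrees with `𝕃⁻¹ J 𝕃`
modulo `ℍ`. -/
theorem hasDerivAt_act (J : S.𝔲) (Υ : Fin d → ℝ) :
    HasDerivAt (fun θ : ℝ => b.act (S.expU (θ • J)) Υ) (b.killing J Υ) 0 ∧
      b.Θ Υ (b.killing J Υ) - (b.𝕃 Υ)⁻¹ * (J : Mat N) * b.𝕃 Υ ∈ S.ℍ := by
  obtain ⟨α, v, ε, hε, hv, hmem, hα⟩ := b.exists_local_action J.2 Υ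
  have hev : (fun θ : ℝ => b.act (S.expU (θ • J)) Υ) =ᶠ[nhds 0] α := by
    filter_upwards [Ioo_mem_nhds (neg_lt_zero.2 hε) hε] with θ hθ
    exact b.act_eq (hα θ hθ)
  have hd : HasDerivAt (fun θ : ℝ => b.act (S.expU (θ • J)) Υ) v 0 := hv.congr_of_eventuallyEq hev
  have hk : b.killing J Υ = v := hd.deriv
  rw [hk]
  refine ⟨hd, ?_⟩
  rw [Θ_eq, 𝕃_eq_expProd]
  exact hmem

theorem contDiff_𝔓 (J : S.𝔲) : ContDiff ℝ ∞ (b.𝔓 J) := by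
  have h : b.𝔓 J = fun Υ => (1 / 2) * (Matrix.traceLinearMap (Fin N) ℝ ℝ).toContinuousLinearMap
      (S.Xc * Ring.inverse (expProd b.T Υ) * (J : Mat N) * expProd b.T Υ) := by
    funext Υ
    rw [inverse_expProd, ← 𝕃_eq_expProd]
    rfl
  rw [h]
  exact contDiff_const.mul ((ContinuousLinearMap.contDiff _).comp
    (((contDiff_const.mul (contDiff_inverse_expProd b.T)).mul contDiff_const).mul
      (contDiff_expProd b.T)))

theorem fderiv_𝔓 (J : S.𝔲) (Υ v : Fin d → ℝ) :
    fderiv ℝ (b.𝔓 J) Υ v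
      = (1 / 2) * (⁅S.Xc, (b.𝕃 Υ)⁻¹ * (J : Mat N) * b.𝕃 Υ⁆ * b.Θ Υ v).trace := by
  have hcurve : HasDerivAt (fun t : ℝ => Υ + t • v) v 0 := by
    simpa using ((hasDerivAt_id (0 : ℝ)).smul_const v).const_add Υ
  have along : ∀ {F : Type} [NormedAddCommGroup F] [NormedSpace ℝ F] (f : (Fin d → ℝ) → F),
      ContDiff ℝ ∞ f → HasDerivAt (fun t : ℝ => f (Υ + t • v)) (fderiv ℝ f Υ v) 0 := by
    intro F _ _ f hf
    have h1 : HasFDerivAt f (fderiv ℝ f Υ) (Υ + (0 : ℝ) • v) := by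
      rw [zero_smul, add_zero]
      exact (hf.differentiable (by simp) Υ).hasFDerivAt
    exact h1.comp_hasDerivAt (0 : ℝ) hcurve
  have hE := along _ (contDiff_expProd b.T)
  have hR := along _ (contDiff_inverse_expProd b.T)
  have hP := along _ (b.contDiff_𝔓 J)
  set E := expProd b.T Υ with hEdef
  set R := Ring.inverse (expProd b.T Υ) with hRdef
  set E' := fderiv ℝ (expProd b.T) Υ v with hE'
  set R' := fderiv ℝ (fun c => Ring.inverse (expProd b.T c)) Υ v with hR'
  have hRE : R * E = 1 := Ring.inverse_mul_cancel _ (isUnit_expProd _ _)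
  have hER : E * R = 1 := Ring.mul_inverse_cancel _ (isUnit_expProd _ _)
  have h0 : R' * E + R * E' = 0 := by
    have h1 := hR.mul hE
    have h2 : HasDerivAt (fun _ : ℝ => (1 : Mat N)) 0 0 := hasDerivAt_const _ _
    have h3 := h1.unique (h2.congr_of_eventuallyEq (Filter.Eventually.of_forall fun t =>
      Ring.inverse_mul_cancel _ (isUnit_expProd _ _)))
    simp only [zero_smul, add_zero] at h3
    exact h3
  have hR'eq : R' = -(R * E' * R) := by
    have h1 : R' * E = -(R * E') := eq_neg_of_add_eq_zero_left h0
    calc R' = R' * (E * R) := by rw [hER, mul_one]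
      _ = (R' * E) * R := by rw [mul_assoc]
      _ = _ := by rw [h1, neg_mul]
  have hθ : b.Θ Υ v = R * E' := by rw [Θ_eq, ← inverse_expProd]
  have h1 : HasDerivAt (fun t : ℝ => b.𝔓 J (Υ + t • v))
      ((1 / 2) * (S.Xc * R' * (J : Mat N) * E + S.Xc * R * (J : Mat N) * E').trace) 0 := by
    have h2 := ((hR.const_mul S.Xc).mul_const (J : Mat N)).mul hE
    have h3 := ((Matrix.traceLinearMap (Fin N) ℝ ℝ).toContinuousLinearMap.hasFDerivAt.comp_hasDerivAt
      (0 : ℝ) h2).const_mul (1 / 2 : ℝ)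
    convert! h3 using 1
    · funext t
      unfold 𝔓
      rw [b.𝕃_eq_expProd, ← inverse_expProd]
      rfl
    · simp only [zero_smul, add_zero]
      rfl
  rw [hP.unique h1, hθ, b.𝕃_eq_expProd, ← inverse_expProd, ← hRdef, ← hEdef, Ring.lie_def, hR'eq]
  congr 1
  -- Inserting `E * R = 1` in the second term turns the derivative into a commutator of `𝕃⁻¹ J 𝕃`
  -- with `Θ`; cyclicity of the trace then moves the bracket onto `Xc`.
  have e1 : S.Xc * -(R * E' * R) * (J : Mat N) * E + S.Xc * R * (J : Mat N) * E'
      = S.Xc * (R * J * E) * (R * E') - S.Xc * (R * E') * (R * J * E) := by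
    have : S.Xc * R * (J : Mat N) * E' = S.Xc * R * J * (E * R) * E' := by rw [hER, mul_one]
    rw [this]
    noncomm_ring
  have e2 : (S.Xc * (R * E') * (R * J * E)).trace = ((R * J * E) * S.Xc * (R * E')).trace := by
    rw [Matrix.trace_mul_comm]
    simp only [mul_assoc]
  rw [e1, sub_mul, Matrix.trace_sub, Matrix.trace_sub, e2]

end SolvableBasis

end KahlerSymmetricSpace

/-! ### Trace identities for the Kähler form. -/

namespace KahlerSymmetricSpace

variable {N : ℕ} {S : KahlerSymmetricSpace N} {d : ℕ}

/-- The components of an element of `𝔲` along `𝕂` are those of its symmetric part. -/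
theorem IsOrthonormalBasis.sum_trace_smul {K : Fin d → Mat N} (hK : S.IsOrthonormalBasis K)
    {X : Mat N} (hX : X ∈ S.𝔲) : ∑ A, (X * K A).trace • K A = (1 / 2 : ℝ) • (X + Xᵀ) := by
  have hsym : (1 / 2 : ℝ) • (X + Xᵀ) ∈ S.𝕂 :=
    ⟨S.𝔲.smul_mem _ (add_mem hX (S.transpose_mem X hX)), by
      rw [Matrix.transpose_smul, Matrix.transpose_add, Matrix.transpose_transpose, add_comm]⟩
  rw [← hK.span_eq] at hsym
  obtain ⟨c, hc⟩ := (Submodule.mem_span_range_iff_exists_fun ℝ).1 hsym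
  have hKs : ∀ A, (K A)ᵀ = K A := fun A => by
    have : K A ∈ S.𝕂 := hK.span_eq ▸ Submodule.subset_span (Set.mem_range_self A)
    exact this.2
  rw [← hc]
  refine Finset.sum_congr rfl fun A _ => ?_
  congr 1
  have h1 : (Xᵀ * K A).trace = (X * K A).trace := by
    rw [← Matrix.trace_transpose, Matrix.transpose_mul, Matrix.transpose_transpose, hKs,
      Matrix.trace_mul_comm]
  calc (X * K A).trace = (((1 / 2 : ℝ) • (X + Xᵀ)) * K A).trace := by
        rw [smul_mul_assoc, Matrix.trace_smul, add_mul, Matrix.trace_add, h1, smul_eq_mul]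
        ring
    _ = ((∑ B, c B • K B) * K A).trace := by rw [hc]
    _ = c A := by
        rw [Finset.sum_mul, Matrix.trace_sum]
        simp only [smul_mul_assoc, Matrix.trace_smul, hK.trace_mul]
        simp

theorem trace_lie_mul_antisymm (X Y Z : Mat N) :
    (⁅X, Y⁆ * Z).trace = -(⁅X, Z⁆ * Y).trace := by
  rw [Ring.lie_def, Ring.lie_def, sub_mul, sub_mul, Matrix.trace_sub, Matrix.trace_sub,
    Matrix.trace_mul_cycle X Y Z, Matrix.trace_mul_cycle Y X Z, Matrix.trace_mul_cycle Z Y X]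
  ring

/-- The Kähler form on the components along `𝕂` of two elements of `𝔲`. -/
theorem sum_Kc_mul_trace (K : Fin d → Mat N) (X Y : Mat N) :
    ∑ A, ∑ B, S.Kc K A B * ((X * K A).trace * (Y * K B).trace)
      = (1 / 2) * (⁅S.Xc, ∑ A, (X * K A).trace • K A⁆ * ∑ B, (Y * K B).trace • K B).trace := by
  rw [lie_sum, Finset.sum_mul_sum, Matrix.trace_sum, Finset.mul_sum]
  refine Finset.sum_congr rfl fun A _ => ?_
  rw [Matrix.trace_sum, Finset.mul_sum]
  refine Finset.sum_congr rfl fun B _ => ?_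
  rw [lie_smul, smul_mul_assoc, mul_smul_comm, Matrix.trace_smul, Matrix.trace_smul, smul_eq_mul,
    smul_eq_mul, Kc]
  ring

/-- `X` and `J` have the same symmetric part, and `Xc` kills the antisymmetric part of `J`, so the
bracket is `⁅Xc, J⁆`. This bracket is symmetric, hence its trace pairing sees only the symmetric
part of `Y`. -/
theorem trace_lie_symm_part {X J Y : Mat N} (hJ : J ∈ S.𝔲) (hXJ : X - J ∈ S.ℍ) :
    (⁅S.Xc, (1 / 2 : ℝ) • (X + Xᵀ)⁆ * ((1 / 2 : ℝ) • (Y + Yᵀ))).trace = (⁅S.Xc, J⁆ * Y).trace := by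
  have hs : (1 / 2 : ℝ) • (X + Xᵀ) = (1 / 2 : ℝ) • (J + Jᵀ) := by
    have h := hXJ.2
    rw [Matrix.transpose_sub] at h
    congr 1
    have : X + Xᵀ - (J + Jᵀ) = (X - J) + (Xᵀ - Jᵀ) := by abel
    rw [← sub_eq_zero, this, h, add_neg_cancel]
  have hanti : ⁅S.Xc, (1 / 2 : ℝ) • (J - Jᵀ)⁆ = 0 := by
    refine S.Xc_central _ (S.𝔲.smul_mem _ (sub_mem hJ (S.transpose_mem J hJ))) ?_
    rw [Matrix.transpose_smul, Matrix.transpose_sub, Matrix.transpose_transpose, ← smul_neg,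
      neg_sub]
  have hJs : ⁅S.Xc, (1 / 2 : ℝ) • (J + Jᵀ)⁆ = ⁅S.Xc, J⁆ := by
    have : J = (1 / 2 : ℝ) • (J + Jᵀ) + (1 / 2 : ℝ) • (J - Jᵀ) := by
      rw [← smul_add, add_add_sub_cancel, ← two_smul ℝ J, smul_smul]
      norm_num
    conv_rhs => rw [this]
    rw [lie_add, hanti, add_zero]
  have hsymm : (⁅S.Xc, J⁆)ᵀ = ⁅S.Xc, J⁆ := by
    rw [← hJs]
    simp only [Ring.lie_def, Matrix.transpose_sub, Matrix.transpose_mul, Matrix.transpose_smul,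
      Matrix.transpose_add, Matrix.transpose_transpose, S.Xc_compact]
    rw [add_comm Jᵀ J, mul_neg, neg_mul]
    abel
  rw [hs, hJs, mul_smul_comm, Matrix.trace_smul, mul_add, Matrix.trace_add]
  have : (⁅S.Xc, J⁆ * Yᵀ).trace = (⁅S.Xc, J⁆ * Y).trace := by
    rw [← Matrix.trace_transpose, Matrix.transpose_mul, Matrix.transpose_transpose, hsymm,
      Matrix.trace_mul_comm]
  rw [this, smul_eq_mul]
  ring

namespace SolvableBasis

variable {r : ℕ} (b : S.SolvableBasis d r)

theorem 𝒦_eq {K : Fin d → Mat N} (hK : S.IsOrthonormalBasis K) (Υ u v : Fin d → ℝ) {J : Mat N}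
    (hJ : J ∈ S.𝔲) (hu : b.Θ Υ u - J ∈ S.ℍ) :
    b.𝒦 K Υ u v = (1 / 2) * (⁅S.Xc, J⁆ * b.Θ Υ v).trace := by
  have h1 := sum_Kc_mul_trace (S := S) K (b.Θ Υ u) (b.Θ Υ v)
  have h2 := sum_Kc_mul_trace (S := S) K (b.Θ Υ v) (b.Θ Υ u)
  -- The sum with `u` and `v` exchanged is minus the original one, so the factor `1 / 2` in the
  -- wedge product is compensated.
  rw [trace_lie_mul_antisymm] at h2
  rw [hK.sum_trace_smul (b.Θ_mem Υ u), hK.sum_trace_smul (b.Θ_mem Υ v),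
    trace_lie_symm_part hJ hu] at h1 h2
  have h3 : b.𝒦 K Υ u v = (1 / 2) * (∑ A, ∑ B, S.Kc K A B *
        ((b.Θ Υ u * K A).trace * (b.Θ Υ v * K B).trace)
      - ∑ A, ∑ B, S.Kc K A B * ((b.Θ Υ v * K A).trace * (b.Θ Υ u * K B).trace)) := by
    unfold 𝒦 wedge V
    rw [← Finset.sum_sub_distrib, Finset.mul_sum]
    refine Finset.sum_congr rfl fun A _ => ?_
    rw [← Finset.sum_sub_distrib, Finset.mul_sum]
    refine Finset.sum_congr rfl fun B _ => ?_
    ring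
  rw [h3, h1, h2]
  ring

end SolvableBasis

end KahlerSymmetricSpace

theorem mainTheorem4 {N d r : ℕ} (S : KahlerSymmetricSpace N) (b : S.SolvableBasis d r)
    (K : Fin d → Mat N) (hK : S.IsOrthonormalBasis K) :
    -- the solvable coordinates are a global chart of `U/H`
    Function.Bijective b.point ∧
    ∀ J : S.𝔲,
      -- `𝔓_J` is a globally defined smooth function
      ContDiff ℝ ∞ (b.𝔓 J) ∧
      ∀ Υ : Fin d → ℝ,
        -- the Killing vector field of `J` exists at `Υ`
        HasDerivAt (fun θ : ℝ => b.act (S.expU (θ • J)) Υ) (b.killing J Υ) 0 ∧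
        -- the moment map equation: the interior product of `𝒦` with it is `d𝔓_J`
        ∀ v : Fin d → ℝ, b.𝒦 K Υ (b.killing J Υ) v = fderiv ℝ (b.𝔓 J) Υ v :=
  ⟨b.point_bijective, fun J => ⟨b.contDiff_𝔓 J, fun Υ =>
    ⟨(b.hasDerivAt_act J Υ).1, fun v =>
      (b.𝒦_eq hK Υ _ v (b.conj_mem J.2 Υ) (b.hasDerivAt_act J Υ).2).trans
        (b.fderiv_𝔓 J Υ v).symm⟩⟩⟩
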